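/- Let $A$ be a simple (possibly nonunital) C*-algebra with Property (SP), i.e. every nonzero hereditary C*-subalgebra of $A$ contains a nonzero projection. For $a,b\ge 0$ in a C*-algebra $B$, write $a\precsim b$ in $B$ (Cuntz subequivalence) if there is a sequence $(v_k)$ in $B$ with $\|a-v_kbv_k^*\|\to0$; and for self-adjoint $a$ and $\varepsilon>0$ let $(a-\varepsilon)_+$ be obtained from $a$ by functional calculus with $t\mapsto\max(t-\varepsilon,0)$. Let $\alpha:G\to\mathrm{Aut}(A)$ be an action of a finite group $G$, $n=|G|$, with the tracial Rokhlin property: for every finite set $S\subseteq A$, every $\eta>0$ and all positive $x_0,y_0\in A$ with $\|x_0\|=1$ there are mutually orthogonal projections $(p_g)_{g\in G}$ in $A$ such that, with $p=\sum_{g\in G}p_g$, (i) $\|p_ga-ap_g\|<\eta$ for all $a\in S$, $g\in G$; (ii) $\|\alpha_g(p_h)-p_{gh}\|<\eta$ for all $g,h\in G$; (iii) $(y_0^2-y_0py_0-\eta)_+\precsim x_0$ in $A$; (iv) $\|px_0p\|>1-\eta$. Regard $A$ as a subalgebra of the crossed product $A\rtimes_\alpha G$, and let $A^\alpha=\{a\in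 A:\alpha_g(a)=a\text{ for all }g\in G\}$. Let $(e_{g,h})_{g,h\in G}$ be the matrix units of $M_n=M_n(\mathbb C)$, with rows and columns indexed by $G$. Then for every finite set $F\subseteq A\rtimes_\alpha G$, every $\varepsilon>0$, and all positive $x,y,z\in A\rtimes_\alpha G$ with $x\ne0$ and $\|z\|=1$, there exist a nonzero projection $e\in A^\alpha$, a C*-subalgebra $D\subseteq e(A\rtimes_\alpha G)e$ with unit $e$, a nonzero projection $f\in A$, and a $*$-isomorphism $\phi:M_n\otimes fAf\to D$ such that: 1. $\phi(e_{1,1}\otimes a)=a$ for all $a\in fAf$, and $\phi(e_{g,g}\otimes f)\in A$ for all $g\in G$; 2. $\|\phi(e_{g,g}\otimes a)-\alpha_g(a)\|\le\varepsilon\|a\|$ for all $a\in fAf$ and $g\in G$; 3. for every $a\in F$ we have $\|ea-ae\|<\varepsilon$, and there are $b_1,b_2\in D$ with $\|ea-b_1\|<\varepsilon$, $\|ae-b_2\|<\varepsilon$ and $\|b_1\|,\|b_2\|\le\|a\|$; 4. $\sum_{g\in G}\phi(e_{g,g}\otimes f)=e$; 5. $(y^2-yey-\varepsilon)_+\precsim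 x$ in $A\rtimes_\alpha G$; 6. $\|eze\|>1-\varepsilon$. -/

import Mathlib

open Filter Topology

noncomputable section

/-! ### C*-algebraic notions -/

section CStarNotions

variable {A : Type*} [NonUnitalCStarAlgebra A]

/-- A C*-algebra is simple if it is nonzero and has no closed two-sided ideals other than
`0` and itself. -/
def IsSimpleCStar (A : Type*) [NonUnitalCStarAlgebra A] : Prop :=
  Nontrivial A ∧ ∀ I : TwoSidedIdeal A, IsClosed (I : Set A) → I = ⊥ ∨ I = ⊤

/-- A hereditary C*-subalgebra: a closed star-subalgebra `B` such that `0 ≤ a ≤ b` with `b ∈ B`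
implies `a ∈ B`. -/
def IsHereditaryCStar [PartialOrder A] (B : NonUnitalStarSubalgebra ℂ A) : Prop :=
  IsClosed (B : Set A) ∧ ∀ a b : A, 0 ≤ a → a ≤ b → b ∈ B → a ∈ B

/-- Property (SP): every nonzero hereditary C*-subalgebra contains a nonzero projection. -/
def PropertySP (A : Type*) [NonUnitalCStarAlgebra A] [PartialOrder A] : Prop :=
  ∀ B : NonUnitalStarSubalgebra ℂ A, IsHereditaryCStar B → B ≠ ⊥ →
    ∃ p ∈ B, IsStarProjection p ∧ p ≠ 0

/-- Cuntz subequivalence of `a` to `b`: there is a sequence `v` with `v n * b * (v n)* → a`. -/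
def CuntzLE (a b : A) : Prop :=
  ∃ v : ℕ → A, Tendsto (fun n => v n * b * star (v n)) atTop (𝓝 a)

/-- `(a - ε)₊`, by continuous functional calculus with the function `t ↦ max (t - ε) 0`, which
vanishes at `0` for `0 ≤ ε`. -/
def cutDown (a : A) (ε : ℝ) : A :=
  cfcₙ (fun t : ℝ => max (t - ε) 0) a

/-- The corner `f A f` of a projection `f`. -/
def cornerAlg (f : A) (hf : IsStarProjection f) : NonUnitalStarSubalgebra ℂ A where
  carrier := {a | ∃ b, a = f * b * f}
  add_mem' := by
    rintro _ _ ⟨a, rfl⟩ ⟨b, rfl⟩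
    exact ⟨a + b, by rw [mul_add, add_mul]⟩
  zero_mem' := ⟨0, by simp⟩
  mul_mem' := by
    rintro _ _ ⟨a, rfl⟩ ⟨b, rfl⟩
    exact ⟨a * f * f * b, by simp only [mul_assoc]⟩
  smul_mem' := by
    rintro c _ ⟨a, rfl⟩
    exact ⟨c • a, by rw [mul_smul_comm, smul_mul_assoc]⟩
  star_mem' := by
    rintro _ ⟨a, rfl⟩
    exact ⟨star a, by simp only [star_mul, hf.isSelfAdjoint.star_eq, mul_assoc]⟩

/-- The projection `f` as an element (the unit) of `f A f`. -/
def cornerUnit (f : A) (hf : IsStarProjection f) : cornerAlg f hf :=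
  ⟨f, f, by rw [hf.isIdempotentElem.eq, hf.isIdempotentElem.eq]⟩

/-- The element `e_{g,h} ⊗ b` of `M_G ⊗ B`, where `M_G = M_{|G|}` has its rows and columns indexed
by `G` and `M_G ⊗ B` is identified with the C*-algebra `M_G(B)` of matrices over `B` in the
canonical way: it is the matrix with `b` at `(g, h)` and zeros elsewhere. -/
def matrixTensor {G B : Type*} [DecidableEq G] [Zero B] (g h : G) (b : B) : CStarMatrix G G B :=
  CStarMatrix.ofMatrix (Matrix.single g h b)

/-- The tracial Rokhlin property of an action of a finite group on a C*-algebra. -/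
def TracialRokhlin [PartialOrder A] {G : Type*} [Group G] [Fintype G]
    (α : G →* (A ≃⋆ₐ[ℂ] A)) : Prop :=
  ∀ (F : Finset A) (ε : ℝ), 0 < ε → ∀ x y : A, 0 ≤ x → 0 ≤ y → ‖x‖ = 1 →
    ∃ p : G → A,
      (∀ g, IsStarProjection (p g)) ∧
      (∀ g h, g ≠ h → p g * p h = 0) ∧
      (∀ a ∈ F, ∀ g, ‖p g * a - a * p g‖ < ε) ∧
      (∀ g h, ‖α g (p h) - p (g * h)‖ < ε) ∧
      CuntzLE (cutDown (y * y - y * (∑ g, p g) * y) ε) x ∧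
      1 - ε < ‖(∑ g, p g) * x * (∑ g, p g)‖

end CStarNotions

/-! ### The crossed product by a finite group -/

section CrossedProduct

variable {A : Type*} [NonUnitalCStarAlgebra A] {G : Type*} [Group G]

/-- The crossed product `A ⋊_α G` of a C*-algebra by a finite group. Its elements are the formal
sums `∑ g, a g • u_g` with `a : G → A`, subject to the covariance relation `u_g a = α_g(a) u_g`. -/
def CrossedProduct (_α : G →* (A ≃⋆ₐ[ℂ] A)) : Type _ := G → A

namespace CrossedProduct

variable {α : G →* (A ≃⋆ₐ[ℂ] A)}

/-- The element `∑ g, a g • u_g`. -/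
def mk (α : G →* (A ≃⋆ₐ[ℂ] A)) (a : G → A) : CrossedProduct α := a

/-- The coefficient at `u_g`. -/
def coeff (a : CrossedProduct α) (g : G) : A := a g

@[ext] theorem ext {a b : CrossedProduct α} (h : ∀ g, coeff a g = coeff b g) : a = b := funext h

instance : AddCommGroup (CrossedProduct α) := inferInstanceAs (AddCommGroup (G → A))

instance : Module ℂ (CrossedProduct α) := inferInstanceAs (Module ℂ (G → A))

/-- The convolution product: `(∑ a_h u_h) (∑ b_k u_k) = ∑ a_h α_h(b_k) u_{hk}`. -/
instance [Fintype G] : Mul (CrossedProduct α) :=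
  ⟨fun a b => mk α fun g => ∑ h, coeff a h * α h (coeff b (h⁻¹ * g))⟩

/-- The involution: `(a_g u_g)* = α_{g⁻¹}(a_g*) u_{g⁻¹}`. -/
instance : Star (CrossedProduct α) :=
  ⟨fun a => mk α fun g => α g (star (coeff a g⁻¹))⟩

@[simp] theorem coeff_mk (a : G → A) (g : G) : coeff (mk α a) g = a g := rfl
@[simp] theorem coeff_zero (g : G) : coeff (0 : CrossedProduct α) g = 0 := rfl
@[simp] theorem coeff_add (a b : CrossedProduct α) (g : G) :
    coeff (a + b) g = coeff a g + coeff b g := rfl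
@[simp] theorem coeff_smul (c : ℂ) (a : CrossedProduct α) (g : G) :
    coeff (c • a) g = c • coeff a g := rfl
@[simp] theorem coeff_mul [Fintype G] (a b : CrossedProduct α) (g : G) :
    coeff (a * b) g = ∑ h, coeff a h * α h (coeff b (h⁻¹ * g)) := rfl
@[simp] theorem coeff_star (a : CrossedProduct α) (g : G) :
    coeff (star a) g = α g (star (coeff a g⁻¹)) := rfl

/-- The regular representation on `M_G(A)`, acting on `ℓ²(G, A)`, as a map: `a u_g` is sent to the
matrix with entry `α_{h⁻¹}(a)` at `(h, g⁻¹ h)` for every `h`, and `0` elsewhere. -/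
def regFun (a : CrossedProduct α) : CStarMatrix G G A :=
  CStarMatrix.ofMatrix fun h k => α h⁻¹ (coeff a (h * k⁻¹))

theorem regFun_apply (a : CrossedProduct α) (h k : G) :
    regFun a h k = α h⁻¹ (coeff a (h * k⁻¹)) := rfl

theorem regFun_injective : Function.Injective (regFun (α := α)) := by
  intro a b hab
  ext g
  have := congrFun (congrFun hab g) 1
  simpa [regFun_apply] using this

theorem regFun_mul [Fintype G] (a b : CrossedProduct α) :
    regFun (a * b) = regFun a * regFun b := by
  refine CStarMatrix.ext fun h k => ?_
  rw [CStarMatrix.mul_apply]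
  simp only [regFun_apply, coeff_mul, map_sum, map_mul]
  refine Fintype.sum_equiv ((Equiv.inv G).trans (Equiv.mulRight h)) _ _ fun s => ?_
  simp only [Equiv.trans_apply, Equiv.inv_apply, Equiv.coe_mulRight, mul_inv_rev, inv_inv,
    mul_inv_cancel_left, ← StarAlgEquiv.mul_apply, ← map_mul, mul_assoc]

theorem regFun_star (a : CrossedProduct α) : regFun (star a) = star (regFun a) := by
  refine CStarMatrix.ext fun h k => ?_
  rw [CStarMatrix.star_apply]
  simp only [regFun_apply, coeff_star, ← map_star, ← StarAlgEquiv.mul_apply, ← map_mul,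
    mul_inv_rev, inv_inv, inv_mul_cancel_left]

instance [Fintype G] : NonUnitalRing (CrossedProduct α) :=
  regFun_injective.nonUnitalRing regFun
    (CStarMatrix.ext fun h k => by simp [regFun_apply])
    (fun a b => CStarMatrix.ext fun h k => by simp [regFun_apply])
    regFun_mul
    (fun a => CStarMatrix.ext fun h k => map_neg (α h⁻¹) _)
    (fun a b => CStarMatrix.ext fun h k => map_sub (α h⁻¹) _ _)
    (fun a n => CStarMatrix.ext fun h k => map_nsmul (α h⁻¹) _ _)
    (fun a n => CStarMatrix.ext fun h k => map_zsmul (α h⁻¹) _ _)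

instance [Fintype G] : StarRing (CrossedProduct α) where
  star_involutive a := regFun_injective (by rw [regFun_star, regFun_star, star_star])
  star_mul a b := regFun_injective (by
    rw [regFun_star, regFun_mul, regFun_mul, regFun_star, regFun_star, star_mul])
  star_add a b := by ext g; simp

/-- The regular representation as a star-homomorphism into `M_G(A)`. -/
def reg [Fintype G] : CrossedProduct α →⋆ₙₐ[ℂ] CStarMatrix G G A where
  toFun := regFun
  map_smul' c a := CStarMatrix.ext fun h k => map_smul (α h⁻¹) c _
  map_zero' := CStarMatrix.ext fun h k => by simp [regFun_apply]
  map_add' a b := CStarMatrix.ext fun h k => by simp [regFun_apply]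
  map_mul' := regFun_mul
  map_star' := regFun_star

theorem reg_injective [Fintype G] : Function.Injective (reg (α := α)) := regFun_injective

theorem range_reg [Fintype G] :
    Set.range (reg (α := α)) =
      ⋂ (h : G) (k : G), {M : CStarMatrix G G A | M h k = α k⁻¹ (M (h * k⁻¹) 1)} := by
  ext M
  simp only [Set.mem_range, Set.mem_iInter, Set.mem_ofPred_eq]
  constructor
  · rintro ⟨a, rfl⟩ h k
    change regFun a h k = α k⁻¹ (regFun a (h * k⁻¹) 1)
    simp only [regFun_apply, ← StarAlgEquiv.mul_apply, ← map_mul, mul_inv_rev, inv_inv, inv_one,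
      mul_one, inv_mul_cancel_left]
  · intro hM
    refine ⟨mk α fun g => α g (M g 1), CStarMatrix.ext fun h k => ?_⟩
    change α h⁻¹ (α (h * k⁻¹) (M (h * k⁻¹) 1)) = M h k
    rw [hM h k]
    simp only [← StarAlgEquiv.mul_apply, ← map_mul, inv_mul_cancel_left]

variable [PartialOrder A] [StarOrderedRing A] [Fintype G]

/-- The C*-norm of the crossed product: the operator norm in the (faithful) regular
representation. -/
instance : NonUnitalNormedRing (CrossedProduct α) :=
  NonUnitalNormedRing.induced (CrossedProduct α) (CStarMatrix G G A) reg reg_injective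

theorem norm_def (a : CrossedProduct α) : ‖a‖ = ‖reg a‖ := rfl

theorem reg_isometry : Isometry (reg (α := α)) :=
  AddMonoidHomClass.isometry_of_norm _ fun _ => rfl

theorem isClosed_range_reg : IsClosed (Set.range (reg (α := α))) := by
  have hc : ∀ h k : G, Continuous fun M : CStarMatrix G G A => M h k :=
    fun h k => continuous_apply_apply h k
  rw [range_reg]
  refine isClosed_iInter fun h => isClosed_iInter fun k => ?_
  exact isClosed_eq (hc h k) ((map_continuous (α k⁻¹)).comp (hc (h * k⁻¹) 1))

theorem completeSpace : CompleteSpace (CrossedProduct α) :=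
  (completeSpace_iff_isComplete_range reg_isometry.isUniformInducing).2
    isClosed_range_reg.isComplete

instance : NonUnitalCStarAlgebra (CrossedProduct α) where
  complete := completeSpace.complete
  norm_mul_self_le a := by
    rw [norm_def, norm_def, map_mul, map_star, CStarRing.norm_star_mul_self]
  norm_smul_le c a := by
    rw [norm_def, norm_def, map_smul, norm_smul]
  smul_assoc c a b := reg_injective (by simp only [smul_eq_mul, map_mul, map_smul, smul_mul_assoc])
  smul_comm c a b := reg_injective (by simp only [smul_eq_mul, map_mul, map_smul, mul_smul_comm])
  star_smul c a := reg_injective (by simp only [map_star, map_smul, star_smul])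

/-- The order of the crossed product: `a ≤ b` if and only if `b - a` is positive. -/
instance : PartialOrder (CrossedProduct α) := CStarAlgebra.spectralOrder _

instance : StarOrderedRing (CrossedProduct α) := CStarAlgebra.spectralOrderedRing _

/-- The canonical inclusion of `A` in the crossed product: `a` is sent to `a u_1`. -/
def incl (α : G →* (A ≃⋆ₐ[ℂ] A)) [DecidableEq G] (a : A) : CrossedProduct α :=
  mk α (Pi.single 1 a)

end CrossedProduct

end CrossedProduct

end

/-!
The proof follows the usual strategy for actions with the tracial Rokhlin property: the Rokhlin
projections `p_g` are perturbed so that their sum becomes exactly invariant, and together with the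
unitaries `u_g` they then yield matrix units in the crossed product.

In detail, the sum `p` of the `p_g` is almost invariant, so averaging and functional calculus give
an invariant projection `e` near `p` (`exists_invariant_projection`). Polar decomposition moves
the `p_g` to orthogonal projections `f_g` with sum `e`, and provides partial isometries `t_g` of
`A` near `p_g`, from `α_g(f)` to `f_g`, where `f = f_1`. Such a family is called a Rokhlin frame
(`IsRokhlinFrame`, `TracialRokhlin.exists_isRokhlinFrame`). In the crossed product the elements
`v_g = t_g u_g` satisfy `v_g* v_h = 0` for `g ≠ h`, `v_g* v_g = f` and `∑ v_g v_g* = e`. Hence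
`e_{g,h} ⊗ a ↦ v_g a v_h*` is an isomorphism of `M_G(f A f)` with a C*-subalgebra `D` of the
corner of `e` (`IsRokhlinFrame.matrixEquiv`). If `d = ∑ d_k u_k`, then the term of `v_g* d v_h`
that comes from `d_k u_k` is small unless `k h = g`, that is, unless it lies in `A`, because
`p_g d_k p_{kh}` is small for `kh ≠ g`. Thus `e d e` is almost in `D`
(`IsRokhlinFrame.exists_mem_subalgebra_near`).

The tracial Rokhlin property controls only elements of `A`, whereas `x`, `y` and `z` belong to the
crossed product. For `y` an approximate unit of `A` suffices
(`CrossedProduct.cuntzLE_cutDown_complement`). For positive `x ≠ 0` the compression `p_g x p_g` is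
almost `p_g x_1 p_g`, and Rørdam's lemma `cuntzLE_cutDown` turns this into a nonzero positive
element of `A` that is Cuntz subequivalent to `x` (`CrossedProduct.exists_incl_cuntzLE`). By
simplicity there is one `c` in `A` of norm one below both `x` and `r²`, where
`r = (z - 1 + ε / 2)₊`. The tracial Rokhlin property for `c` makes the complement of `e` small
relative to `x` and makes `e c e` large. The latter bounds `‖r e‖` below by a constant that does not depend on `e`,
and since `r z r` is at least `(1 - ε / 2) r²` and `e` almost commutes with `r`, the norm of
`e z e` exceeds `1 - ε` (`mul_norm_sq_le_norm_corner`).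
-/

noncomputable section

/-! ### Cuntz subequivalence -/

section CuntzSubequivalence

variable {A : Type*} [NonUnitalCStarAlgebra A]

theorem cuntzLE_iff {a b : A} :
    CuntzLE a b ↔ ∀ δ : ℝ, 0 < δ → ∃ v : A, ‖v * b * star v - a‖ < δ := by
  constructor
  · rintro ⟨v, hv⟩ δ hδ
    obtain ⟨n, hn⟩ := ((tendsto_iff_norm_sub_tendsto_zero.1 hv).eventually_lt_const hδ).exists
    exact ⟨v n, hn⟩
  · intro h
    choose v hv using fun n : ℕ => h (1 / ((n : ℝ) + 1)) Nat.one_div_pos_of_nat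
    refine ⟨v, tendsto_iff_norm_sub_tendsto_zero.2 ?_⟩
    exact squeeze_zero (fun _ => norm_nonneg _) (fun n => (hv n).le)
      tendsto_one_div_add_atTop_nhds_zero_nat

theorem CuntzLE.conj (v b : A) : CuntzLE (v * b * star v) b :=
  ⟨fun _ => v, tendsto_const_nhds⟩

theorem CuntzLE.trans {a b c : A} (hab : CuntzLE a b) (hbc : CuntzLE b c) : CuntzLE a c := by
  rw [cuntzLE_iff] at hab ⊢
  intro δ hδ
  obtain ⟨v, hv⟩ := hab (δ / 2) (half_pos hδ)
  obtain ⟨w, hw⟩ := hbc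
  have h : Tendsto (fun n => v * (w n * c * star (w n)) * star v) atTop (𝓝 (v * b * star v)) :=
    (hw.const_mul v).mul_const _
  obtain ⟨n, hn⟩ := ((tendsto_iff_norm_sub_tendsto_zero.1 h).eventually_lt_const
    (half_pos hδ)).exists
  refine ⟨v * w n, ?_⟩
  have e : v * w n * c * star (v * w n) - a =
      (v * (w n * c * star (w n)) * star v - v * b * star v) + (v * b * star v - a) := by
    simp only [star_mul, mul_assoc]; abel
  rw [e]
  exact (norm_add_le _ _).trans_lt (by linarith)

theorem NonUnitalStarAlgHom.continuous_of_cstar {B : Type*} [NonUnitalCStarAlgebra B]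
    (φ : A →⋆ₙₐ[ℂ] B) : Continuous φ :=
  AddMonoidHomClass.continuous_of_bound φ 1 fun a => by
    simpa using NonUnitalStarAlgHom.norm_apply_le φ a

theorem CuntzLE.map {B : Type*} [NonUnitalCStarAlgebra B] (φ : A →⋆ₙₐ[ℂ] B) {a b : A}
    (h : CuntzLE a b) : CuntzLE (φ a) (φ b) := by
  obtain ⟨v, hv⟩ := h
  refine ⟨fun n => φ (v n), ?_⟩
  have := (φ.continuous_of_cstar.tendsto a).comp hv
  simpa [Function.comp_def, map_star] using this

theorem map_cutDown {B : Type*} [NonUnitalCStarAlgebra B] (φ : A →⋆ₙₐ[ℂ] B) {a : A}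
    (ha : IsSelfAdjoint a) {ε : ℝ} (hε : 0 ≤ ε) : φ (cutDown a ε) = cutDown (φ a) ε :=
  NonUnitalStarAlgHom.map_cfcₙ φ _ a (by fun_prop) (by simp [hε]) φ.continuous_of_cstar ha
    (ha.map φ)

variable [PartialOrder A] [StarOrderedRing A]

theorem cutDown_nonneg (a : A) (ε : ℝ) : 0 ≤ cutDown a ε :=
  cfcₙ_nonneg fun _ _ => le_max_right _ _

theorem norm_cutDown_sub_le {a : A} (ha : 0 ≤ a) {ε : ℝ} (hε : 0 ≤ ε) :
    ‖cutDown a ε - a‖ ≤ ε := by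
  have hsa : IsSelfAdjoint a := ha.isSelfAdjoint
  nth_rw 2 [← cfcₙ_id' ℝ a]
  rw [cutDown, ← cfcₙ_sub _ _ a (by fun_prop) (by simp [hε])]
  refine norm_cfcₙ_le fun t ht => ?_
  have ht0 : 0 ≤ t := quasispectrum_nonneg_of_nonneg a ha t ht
  rw [Real.norm_eq_abs, abs_le]
  rcases max_cases (t - ε) 0 with h | h <;> constructor <;> linarith

theorem norm_cutDown_le {a : A} (ha : 0 ≤ a) {ε : ℝ} (hε : 0 ≤ ε) : ‖cutDown a ε‖ ≤ ‖a‖ := by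
  refine norm_cfcₙ_le fun t ht => ?_
  have ht0 : 0 ≤ t := quasispectrum_nonneg_of_nonneg a ha t ht
  have : ‖t‖ ≤ ‖a‖ := by
    have hsa : IsSelfAdjoint a := ha.isSelfAdjoint
    have := norm_apply_le_norm_cfcₙ (fun t : ℝ => t) a ht
    rwa [cfcₙ_id' ℝ a] at this
  rw [Real.norm_eq_abs, abs_of_nonneg ht0] at this
  rw [Real.norm_eq_abs, abs_of_nonneg (le_max_right _ _)]
  exact max_le (by linarith) (norm_nonneg _)

/-- Positive elements are Cuntz subequivalent to everything that dominates them: with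
`y = √x` and `m(t) = t / (t + δ)`, the element `y m(c)` converges to `y` as `δ → 0`. -/
theorem cuntzLE_of_le {x c : A} (hx : 0 ≤ x) (hxc : x ≤ c) : CuntzLE x c := by
  have hc : 0 ≤ c := hx.trans hxc
  have hcs : IsSelfAdjoint c := hc.isSelfAdjoint
  have hid : Continuous fun t : ℝ => t := continuous_id
  obtain ⟨y, hy0, hyx⟩ : ∃ y : A, 0 ≤ y ∧ y * y = x :=
    ⟨CFC.sqrt x, CFC.sqrt_nonneg x, CFC.sqrt_mul_sqrt_self x hx⟩
  have hys : star y = y := hy0.isSelfAdjoint.star_eq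
  -- the witness is `v = y k` with `k = √c (c + δ)⁻¹`, so that `v c v* = y m² y`
  have key : ∀ δ : ℝ, 0 < δ → ∃ v : A, ‖v * c * star v - x‖ ≤ 2 * √δ * ‖y‖ := by
    intro δ hδ
    have hpos : ∀ t : ℝ, |t| + δ ≠ 0 := fun t => by positivity
    let mf : ℝ → ℝ := fun t => t / (|t| + δ)
    let kf : ℝ → ℝ := fun t => √t / (|t| + δ)
    have hmc : Continuous mf := continuous_id.div (by fun_prop) hpos
    have hkc : Continuous kf := Real.continuous_sqrt.div (by fun_prop) hpos
    have hm0 : mf 0 = 0 := by simp [mf]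
    have hk0 : kf 0 = 0 := by simp [kf]
    set m := cfcₙ mf c with hm
    set k := cfcₙ kf c with hk
    have hms : star m = m := (cfcₙ_predicate mf c : IsSelfAdjoint m).star_eq
    have hks : star k = k := (cfcₙ_predicate kf c : IsSelfAdjoint k).star_eq
    have hspec : ∀ t ∈ quasispectrum ℝ c, 0 ≤ t := quasispectrum_nonneg_of_nonneg c hc
    have hkck : k * c * k = m * m := by
      have j : ContinuousOn (fun t => kf t * t) (quasispectrum ℝ c) :=
        (hkc.mul hid).continuousOn
      have e : k * c = cfcₙ (fun t => kf t * t) c := by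
        rw [cfcₙ_mul kf _ c hkc.continuousOn hk0 hid.continuousOn rfl, cfcₙ_id' ℝ c]
      rw [e, hk, hm, ← cfcₙ_mul _ kf c j (by simp) hkc.continuousOn hk0,
        ← cfcₙ_mul mf mf c hmc.continuousOn hm0 hmc.continuousOn hm0]
      refine cfcₙ_congr fun t ht => ?_
      have h0 := hspec t ht
      have h1 := Real.mul_self_sqrt h0
      have h2 := hpos t
      simp only [kf, mf]
      field_simp
      rw [Real.sq_sqrt h0]; ring
    have hm1 : ‖m‖ ≤ 1 := by
      refine norm_cfcₙ_le fun t ht => ?_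
      simp only [mf, norm_div, Real.norm_eq_abs]
      rw [abs_of_pos (by positivity : 0 < |t| + δ)]
      exact (div_le_one (by positivity)).2 (by linarith)
    have hd : ‖y - y * m‖ ≤ √δ := by
      apply Real.le_sqrt_of_sq_le
      rw [sq, ← CStarRing.norm_star_mul_self]
      have e1 : star (y - y * m) * (y - y * m) = x - m * x - x * m + m * x * m := by
        rw [star_sub, star_mul, hms, hys, ← hyx]; noncomm_ring
      have hle : star (y - y * m) * (y - y * m) ≤ c - m * c - c * m + m * c * m := by
        rw [e1, ← sub_nonneg]
        obtain ⟨s, hs0, hs⟩ : ∃ s : A, 0 ≤ s ∧ s * s = c - x :=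
          ⟨CFC.sqrt (c - x), CFC.sqrt_nonneg _, CFC.sqrt_mul_sqrt_self _ (sub_nonneg.2 hxc)⟩
        have e2 : c - m * c - c * m + m * c * m - (x - m * x - x * m + m * x * m) =
            star (s - s * m) * (s - s * m) := by
          rw [star_sub, star_mul, hms, hs0.isSelfAdjoint.star_eq]
          have : c = s * s + x := by rw [hs]; abel
          rw [this]; noncomm_ring
        rw [e2]
        exact star_mul_self_nonneg _
      refine (CStarAlgebra.norm_le_norm_of_nonneg_of_le (star_mul_self_nonneg _) hle).trans ?_
      have e3 : c - m * c - c * m + m * c * m =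
          cfcₙ (fun t => t - mf t * t - t * mf t + mf t * t * mf t) c := by
        have i1 : ContinuousOn (fun t => mf t * t) (quasispectrum ℝ c) :=
          (hmc.mul hid).continuousOn
        have i2 : ContinuousOn (fun t => t * mf t) (quasispectrum ℝ c) :=
          (hid.mul hmc).continuousOn
        have i3 : ContinuousOn (fun t => mf t * t * mf t) (quasispectrum ℝ c) :=
          ((hmc.mul hid).mul hmc).continuousOn
        rw [cfcₙ_add (fun t => t - mf t * t - t * mf t) (fun t => mf t * t * mf t) c
            ((hid.continuousOn.sub i1).sub i2) (by simp) i3 (by simp),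
          cfcₙ_sub (fun t => t - mf t * t) (fun t => t * mf t) c
            (hid.continuousOn.sub i1) (by simp) i2 (by simp),
          cfcₙ_sub (fun t => t) (fun t => mf t * t) c hid.continuousOn rfl i1 (by simp),
          cfcₙ_mul (fun t => mf t * t) mf c i1 (by simp) hmc.continuousOn hm0,
          cfcₙ_mul (fun t => t) mf c hid.continuousOn rfl hmc.continuousOn hm0,
          cfcₙ_mul mf (fun t => t) c hmc.continuousOn hm0 hid.continuousOn rfl, cfcₙ_id' ℝ c]
      rw [e3]
      refine norm_cfcₙ_le fun t ht => ?_
      have h0 := hspec t ht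
      -- the function is `t (1 - m(t))² = t δ² / (t + δ)²`
      have e4 : t - mf t * t - t * mf t + mf t * t * mf t = δ * (t / (t + δ)) * (δ / (t + δ)) := by
        simp only [mf, abs_of_nonneg h0]
        field_simp
        ring
      rw [e4, Real.norm_eq_abs, abs_of_nonneg (by positivity)]
      have a1 : t / (t + δ) ≤ 1 := (div_le_one (by positivity)).2 (by linarith)
      have a2 : δ / (t + δ) ≤ 1 := (div_le_one (by positivity)).2 (by linarith)
      calc δ * (t / (t + δ)) * (δ / (t + δ)) ≤ δ * 1 * 1 := by gcongr
        _ = δ := by ring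
    refine ⟨y * k, ?_⟩
    have e5 : y * k * c * star (y * k) - x = (y * m - y) * m * y + y * (m * y - y) := by
      have : y * k * c * star (y * k) = y * (k * c * k) * y := by
        rw [star_mul, hys, hks]; noncomm_ring
      rw [this, hkck, ← hyx]; noncomm_ring
    have hd' : ‖m * y - y‖ ≤ √δ := by
      rw [← norm_star, star_sub, star_mul, hys, hms, norm_sub_rev]; exact hd
    rw [norm_sub_rev] at hd
    rw [e5]
    calc ‖(y * m - y) * m * y + y * (m * y - y)‖
        ≤ ‖y * m - y‖ * ‖m‖ * ‖y‖ + ‖y‖ * ‖m * y - y‖ := by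
          refine (norm_add_le _ _).trans (add_le_add ?_ (norm_mul_le _ _))
          exact (norm_mul_le _ _).trans (by gcongr; exact norm_mul_le _ _)
      _ ≤ √δ * 1 * ‖y‖ + ‖y‖ * √δ := by gcongr
      _ = 2 * √δ * ‖y‖ := by ring
  rw [cuntzLE_iff]
  intro δ hδ
  obtain ⟨v, hv⟩ := key ((δ / (4 * (‖y‖ + 1))) ^ 2) (by positivity)
  refine ⟨v, hv.trans_lt ?_⟩
  rw [Real.sqrt_sq (by positivity)]
  have : ‖y‖ / (‖y‖ + 1) ≤ 1 := (div_le_one (by positivity)).2 (by linarith)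
  calc 2 * (δ / (4 * (‖y‖ + 1))) * ‖y‖ = δ / 2 * (‖y‖ / (‖y‖ + 1)) := by field_simp; ring
    _ ≤ δ / 2 * 1 := by gcongr
    _ < δ := by linarith

/-- Rørdam's lemma: if `b` is within `ε` of `a`, then `(a - ε)₊ ≾ b`. -/
theorem cuntzLE_cutDown {a b : A} (ha : IsSelfAdjoint a) (hb : 0 ≤ b) {ε : ℝ}
    (hab : ‖a - b‖ < ε) : CuntzLE (cutDown a ε) b := by
  set r := ‖a - b‖ with hr
  have hr0 : 0 ≤ r := norm_nonneg _
  have hε : 0 < ε := hr0.trans_lt hab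
  -- the function `h` is chosen with `h(t)² (t - r) = max (t - ε) 0`
  let h : ℝ → ℝ := fun t => √(max (t - ε) 0 / (max t ε - r))
  have hden : ∀ t : ℝ, 0 < max t ε - r := fun t => by linarith [le_max_right t ε]
  have hc : Continuous h := Real.continuous_sqrt.comp
    (Continuous.div (by fun_prop) (by fun_prop) fun t => (hden t).ne')
  have h0 : h 0 = 0 := by simp [h, hε.le]
  set u := cfcₙ h a with hu
  have hus : star u = u := (cfcₙ_predicate h a : IsSelfAdjoint u).star_eq
  have e1 : cutDown a ε = u * a * u - r • (u * u) := by
    have hid : Continuous fun t : ℝ => t := continuous_id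
    have i1 : ContinuousOn (fun t => h t * t) (quasispectrum ℝ a) := (hc.mul hid).continuousOn
    have i2 : ContinuousOn (fun t => h t * h t) (quasispectrum ℝ a) := (hc.mul hc).continuousOn
    have i3 : ContinuousOn (fun t => h t * t * h t) (quasispectrum ℝ a) :=
      ((hc.mul hid).mul hc).continuousOn
    have e : u * a = cfcₙ (fun t => h t * t) a := by
      rw [cfcₙ_mul h _ a hc.continuousOn h0 hid.continuousOn rfl, cfcₙ_id' ℝ a]
    rw [e, hu, ← cfcₙ_mul _ h a i1 (by simp) hc.continuousOn h0,
      ← cfcₙ_mul h h a hc.continuousOn h0 hc.continuousOn h0,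
      ← cfcₙ_smul r _ a i2 (by simp [h0]),
      ← cfcₙ_sub (fun t => h t * t * h t) (fun t => r • (h t * h t)) a i3 (by simp)
        (i2.const_smul r) (by simp [h0])]
    refine cfcₙ_congr fun t _ => ?_
    have hsq : h t * h t = max (t - ε) 0 / (max t ε - r) :=
      Real.mul_self_sqrt (div_nonneg (le_max_right _ _) (hden t).le)
    have : h t * t * h t - r • (h t * h t) = h t * h t * (t - r) := by
      simp only [smul_eq_mul]; ring
    change max (t - ε) 0 = h t * t * h t - r • (h t * h t)
    rw [this, hsq]
    rcases le_total t ε with ht | ht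
    · simp [ht]
    · rw [max_eq_left (sub_nonneg.2 ht), max_eq_left ht]
      have : t - r ≠ 0 := by linarith
      field_simp
  have hle : cutDown a ε ≤ u * b * star u := by
    have := CStarAlgebra.star_left_conjugate_le_norm_smul (a := u) (b := a - b)
      (ha.sub hb.isSelfAdjoint)
    rw [hus, ← hr, mul_sub, sub_mul, sub_le_iff_le_add] at this
    rw [e1, hus, sub_le_iff_le_add, add_comm]
    exact this
  exact (cuntzLE_of_le (cutDown_nonneg a ε) hle).trans (CuntzLE.conj u b)

end CuntzSubequivalence

/-! ### Perturbation of projections -/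

section Projections

variable {A : Type*} [NonUnitalCStarAlgebra A]

theorem IsStarProjection.norm_le_one {p : A} (hp : IsStarProjection p) : ‖p‖ ≤ 1 := by
  have h := CStarRing.norm_star_mul_self (x := p)
  rw [hp.isSelfAdjoint.star_eq, hp.isIdempotentElem.eq] at h
  nlinarith [norm_nonneg p]

theorem IsStarProjection.eq_zero_of_norm_lt_one {p : A} (hp : IsStarProjection p)
    (h1 : ‖p‖ < 1) : p = 0 := by
  have h := CStarRing.norm_star_mul_self (x := p)
  rw [hp.isSelfAdjoint.star_eq, hp.isIdempotentElem.eq] at h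
  rw [← norm_eq_zero]
  nlinarith [norm_nonneg p]

theorem IsStarProjection.eq_of_mul_eq_right {p q : A} (hp : IsStarProjection p)
    (hq : IsStarProjection q) (h : p * q = q) (hn : ‖p - q‖ < 1) : p = q :=
  sub_eq_zero.1 ((hq.sub_of_mul_eq_right hp h).eq_zero_of_norm_lt_one hn)

/-- The piecewise linear function that is `0` on `(-∞, 1/4]` and `1` on `[3/4, ∞)`. -/
def ramp (t : ℝ) : ℝ := max 0 (min 1 (2 * t - 1 / 2))

@[fun_prop]
theorem continuous_ramp : Continuous ramp := by unfold ramp; fun_prop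

theorem ramp_zero : ramp 0 = 0 := by norm_num [ramp]

theorem ramp_of_le {t : ℝ} (h : t ≤ 1 / 4) : ramp t = 0 := by
  rw [ramp, max_eq_left]; exact (min_le_right _ _).trans (by linarith)

theorem ramp_of_ge {t : ℝ} (h : 3 / 4 ≤ t) : ramp t = 1 := by
  rw [ramp, min_eq_left (by linarith)]; norm_num

theorem le_or_ge_of_abs_sq_sub_le {t : ℝ} (h : |t * t - t| ≤ 3 / 16) : t ≤ 1 / 4 ∨ 3 / 4 ≤ t := by
  by_contra! hc
  have := (abs_le.1 h).1
  nlinarith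

theorem abs_ramp_sub_le {t : ℝ} (h : |t * t - t| ≤ 3 / 16) : |ramp t - t| ≤ 2 * |t * t - t| := by
  have e : |t * t - t| = |t| * |1 - t| := by rw [← abs_mul, ← abs_neg]; congr 1; ring
  rcases le_or_ge_of_abs_sq_sub_le h with ht | ht
  · rw [ramp_of_le ht, zero_sub, abs_neg, e, abs_of_nonneg (a := 1 - t) (by linarith)]
    nlinarith [abs_nonneg t]
  · rw [ramp_of_ge ht, e, abs_of_nonneg (a := t) (by linarith)]
    nlinarith [abs_nonneg (1 - t)]

theorem abs_sq_sub_le_of_mem_quasispectrum {a : A} (ha : IsSelfAdjoint a) {t : ℝ}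
    (ht : t ∈ quasispectrum ℝ a) : |t * t - t| ≤ ‖a * a - a‖ := by
  have hid : Continuous fun t : ℝ => t := continuous_id
  have := norm_apply_le_norm_cfcₙ (fun t : ℝ => t * t - t) a ht
  rwa [cfcₙ_sub (fun t : ℝ => t * t) (fun t => t) a (hid.mul hid).continuousOn (by simp)
    hid.continuousOn rfl, cfcₙ_mul (fun t : ℝ => t) (fun t => t) a hid.continuousOn rfl
    hid.continuousOn rfl, cfcₙ_id' ℝ a] at this

/-- An almost idempotent self-adjoint element is turned into a projection by `ramp`. -/
theorem isStarProjection_cfcₙ_ramp {a : A} (ha : IsSelfAdjoint a) (h : ‖a * a - a‖ ≤ 3 / 16) :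
    IsStarProjection (cfcₙ ramp a) where
  isIdempotentElem := by
    rw [IsIdempotentElem, ← cfcₙ_mul ramp ramp a (by fun_prop) ramp_zero (by fun_prop) ramp_zero]
    refine cfcₙ_congr fun t ht => ?_
    rcases le_or_ge_of_abs_sq_sub_le ((abs_sq_sub_le_of_mem_quasispectrum ha ht).trans h) with h | h
    · simp [ramp_of_le h]
    · simp [ramp_of_ge h]
  isSelfAdjoint := cfcₙ_predicate _ _

theorem norm_cfcₙ_ramp_sub_le {a : A} (ha : IsSelfAdjoint a) (h : ‖a * a - a‖ ≤ 3 / 16) :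
    ‖cfcₙ ramp a - a‖ ≤ 2 * ‖a * a - a‖ := by
  have hid : Continuous fun t : ℝ => t := continuous_id
  have e : cfcₙ ramp a - a = cfcₙ (fun t => ramp t - t) a := by
    rw [cfcₙ_sub ramp (fun t => t) a (by fun_prop) ramp_zero hid.continuousOn rfl, cfcₙ_id' ℝ a]
  rw [e]
  refine norm_cfcₙ_le fun t ht => ?_
  have h1 := abs_sq_sub_le_of_mem_quasispectrum ha ht
  exact (abs_ramp_sub_le (h1.trans h)).trans (by linarith)

theorem norm_mul_self_sub_le {p a : A} (hp : IsStarProjection p) {δ : ℝ} (h : ‖a - p‖ ≤ δ)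
    (hδ : δ ≤ 1) : ‖a * a - a‖ ≤ 4 * δ := by
  have e : a * a - a = (a - p) * (a - p) + p * (a - p) + (a - p) * p - (a - p) := by
    have := hp.isIdempotentElem.eq
    simp only [mul_sub, sub_mul, this]; abel
  have hp1 := hp.norm_le_one
  have h0 := norm_nonneg (a - p)
  rw [e]
  calc _ ≤ ‖a - p‖ * ‖a - p‖ + ‖p‖ * ‖a - p‖ + ‖a - p‖ * ‖p‖ + ‖a - p‖ :=
        (norm_sub_le _ _).trans (add_le_add (norm_add₃_le.trans (add_le_add (add_le_add
          (norm_mul_le _ _) (norm_mul_le _ _)) (norm_mul_le _ _))) le_rfl)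
    _ ≤ δ * 1 + 1 * δ + δ * 1 + δ := by
        have hδ0 := h0.trans h
        gcongr
        exact h.trans hδ
    _ = 4 * δ := by ring

/-- The continuous function `√(ramp t / t)`, used for the polar decomposition of `q p`. -/
def rampInvSqrt (t : ℝ) : ℝ := √(ramp t / max t (1 / 4))

theorem max_quarter_pos (t : ℝ) : 0 < max t (1 / 4) := by
  have := le_max_right t (1 / 4); linarith

@[fun_prop]
theorem continuous_rampInvSqrt : Continuous rampInvSqrt :=
  Real.continuous_sqrt.comp (continuous_ramp.div (by fun_prop) fun t => (max_quarter_pos t).ne')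

theorem rampInvSqrt_of_le {t : ℝ} (h : t ≤ 1 / 4) : rampInvSqrt t = 0 := by
  simp [rampInvSqrt, ramp_of_le h]

theorem rampInvSqrt_zero : rampInvSqrt 0 = 0 := rampInvSqrt_of_le (by norm_num)

theorem mul_rampInvSqrt_sq (t : ℝ) : rampInvSqrt t * t * rampInvSqrt t = ramp t := by
  rcases le_total t (1 / 4) with h | h
  · simp [rampInvSqrt_of_le h, ramp_of_le h]
  · have h1 : 0 ≤ ramp t := le_max_left _ _
    have h2 : rampInvSqrt t * rampInvSqrt t = ramp t / t := by
      rw [rampInvSqrt, max_eq_left h, Real.mul_self_sqrt (div_nonneg h1 (by linarith))]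
    have h3 : t ≠ 0 := by linarith
    calc _ = rampInvSqrt t * rampInvSqrt t * t := by ring
      _ = ramp t := by rw [h2]; field_simp

theorem abs_rampInvSqrt_sub_le {t : ℝ} (h : |t * t - t| ≤ 3 / 16) :
    |rampInvSqrt t - ramp t| ≤ 2 * |t * t - t| := by
  rcases le_or_ge_of_abs_sq_sub_le h with ht | ht
  · simp [rampInvSqrt_of_le ht, ramp_of_le ht]
  · have h0 : 0 ≤ rampInvSqrt t := Real.sqrt_nonneg _
    have h1 := mul_rampInvSqrt_sq t
    rw [ramp_of_ge ht] at h1 ⊢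
    set s := rampInvSqrt t
    -- `(s - 1) (s + 1) = s² (1 - t)` and `s² ≤ 4 / 3`
    have e : |s - 1| * (s + 1) = s * s * |1 - t| := by
      have e0 : (s - 1) * (s + 1) = s * s * (1 - t) := by linear_combination h1
      have := congrArg abs e0
      rwa [abs_mul, abs_mul, abs_of_nonneg (by linarith : 0 ≤ s + 1),
        abs_of_nonneg (mul_nonneg h0 h0)] at this
    have e2 : |t * t - t| = t * |1 - t| := by
      have e0 : t * t - t = t * (t - 1) := by ring
      rw [e0, abs_mul, abs_of_nonneg (by linarith : 0 ≤ t), abs_sub_comm]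
    rw [e2]
    have h2 : s * s ≤ 4 / 3 := by nlinarith [mul_nonneg h0 h0]
    have h3 := abs_nonneg (1 - t)
    have h4 : |s - 1| ≤ s * s * |1 - t| := by nlinarith [abs_nonneg (s - 1)]
    nlinarith

/-- Close projections are equivalent through a partial isometry close to them, obtained from the
polar decomposition of `q p`. -/
theorem IsStarProjection.exists_partialIsometry {p q : A} (hp : IsStarProjection p)
    (hq : IsStarProjection q) {δ : ℝ} (hpq : ‖q - p‖ ≤ δ) (hδ : δ ≤ 1 / 16) :
    ∃ s : A, star s * s = p ∧ s * star s = q ∧ ‖s - p‖ ≤ 4 * δ := by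
  have hpp := hp.isIdempotentElem.eq
  have hqq := hq.isIdempotentElem.eq
  have hps := hp.isSelfAdjoint.star_eq
  have hqs := hq.isSelfAdjoint.star_eq
  have hp1 := hp.norm_le_one
  have hq1 := hq.norm_le_one
  have hδ0 : 0 ≤ δ := (norm_nonneg _).trans hpq
  set a := p * q * p with ha
  have hasa : IsSelfAdjoint a := by
    rw [IsSelfAdjoint, ha, star_mul, star_mul, hps, hqs, mul_assoc]
  have hap : ‖a - p‖ ≤ δ := by
    have e : a - p = p * (q - p) * p := by rw [mul_sub, sub_mul, hpp, hpp]
    rw [e]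
    calc _ ≤ ‖p‖ * ‖q - p‖ * ‖p‖ :=
          (norm_mul_le _ _).trans (by gcongr; exact norm_mul_le _ _)
      _ ≤ 1 * δ * 1 := by gcongr
      _ = δ := by ring
  have haa : ‖a * a - a‖ ≤ δ := by
    have e : a * a - a = p * q * (p - q) * q * p := by
      have h1 : a * a = p * q * p * q * p := by
        rw [ha]; simp only [mul_assoc]; rw [← mul_assoc p p, hpp]
      have h2 : p * q * q * q * p = a := by
        rw [ha, mul_assoc p q q, hqq, mul_assoc p q q, hqq]
      rw [h1, mul_sub, sub_mul, sub_mul, h2]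
    rw [e]
    calc _ ≤ ‖p‖ * ‖q‖ * ‖p - q‖ * ‖q‖ * ‖p‖ := by
          refine (norm_mul_le _ _).trans ?_
          gcongr
          refine (norm_mul_le _ _).trans ?_
          gcongr
          refine (norm_mul_le _ _).trans ?_
          gcongr
          exact norm_mul_le _ _
      _ ≤ 1 * 1 * δ * 1 * 1 := by gcongr; rwa [norm_sub_rev]
      _ = δ := by ring
  have haa' : ‖a * a - a‖ ≤ 3 / 16 := haa.trans (by linarith)
  set χ := cfcₙ ramp a with hχ
  set w := cfcₙ rampInvSqrt a with hw
  have hχ_proj : IsStarProjection χ := isStarProjection_cfcₙ_ramp hasa haa'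
  have hws : star w = w := (cfcₙ_predicate rampInvSqrt a : IsSelfAdjoint w).star_eq
  have hid : Continuous fun t : ℝ => t := continuous_id
  -- `χ` turns out to be `p`, and `w` is the inverse square root of `a` in the corner of `p`
  have hwaw : w * a * w = χ := by
    have i1 : ContinuousOn (fun t => rampInvSqrt t * t) (quasispectrum ℝ a) := by fun_prop
    have e : w * a = cfcₙ (fun t => rampInvSqrt t * t) a := by
      rw [cfcₙ_mul rampInvSqrt (fun t => t) a (by fun_prop) rampInvSqrt_zero hid.continuousOn rfl,
        cfcₙ_id' ℝ a]
    rw [e, hw, ← cfcₙ_mul _ rampInvSqrt a i1 (by simp) (by fun_prop) rampInvSqrt_zero, hχ]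
    exact cfcₙ_congr fun t _ => mul_rampInvSqrt_sq t
  have hpw : p * w = w := by
    let o : ℝ → ℝ := fun t => rampInvSqrt t / max t (1 / 4)
    have ho : Continuous o :=
      continuous_rampInvSqrt.div (by fun_prop) fun t => (max_quarter_pos t).ne'
    have ho0 : o 0 = 0 := by simp [o, rampInvSqrt_zero]
    have e : w = a * cfcₙ o a := by
      have e1 : a * cfcₙ o a = cfcₙ (fun t => t * o t) a := by
        rw [cfcₙ_mul (fun t => t) o a hid.continuousOn rfl ho.continuousOn ho0, cfcₙ_id' ℝ a]
      rw [e1, hw]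
      refine cfcₙ_congr fun t _ => ?_
      rcases le_total t (1 / 4) with h | h
      · simp [o, rampInvSqrt_of_le h]
      · have : t ≠ 0 := by linarith
        simp only [o, max_eq_left h]
        field_simp
    rw [e, ← mul_assoc, ha, ← mul_assoc, ← mul_assoc, hpp]
  have hwp : w * p = w := by simpa [hws, hps] using congrArg star hpw
  have hχp : p = χ := by
    refine hp.eq_of_mul_eq_right hχ_proj ?_ ?_
    · rw [← hwaw, ← mul_assoc, ← mul_assoc, hpw]
    · have := norm_cfcₙ_ramp_sub_le hasa haa'
      calc ‖p - χ‖ ≤ ‖p - a‖ + ‖a - χ‖ := norm_sub_le_norm_sub_add_norm_sub _ _ _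
        _ ≤ δ + 2 * δ := by
          rw [norm_sub_rev p, norm_sub_rev a χ]
          refine add_le_add hap ?_
          rw [hχ]
          linarith
        _ < 1 := by linarith
  have hwχ : ‖w - p‖ ≤ 2 * δ := by
    rw [hχp, hw, hχ, ← cfcₙ_sub rampInvSqrt ramp a (by fun_prop) rampInvSqrt_zero (by fun_prop)
      ramp_zero]
    refine norm_cfcₙ_le fun t ht => ?_
    have h1 := abs_sq_sub_le_of_mem_quasispectrum hasa ht
    exact (abs_rampInvSqrt_sub_le (h1.trans haa')).trans (by linarith)
  have hw2 : ‖w‖ ≤ 2 := by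
    calc ‖w‖ = ‖(w - p) + p‖ := by rw [sub_add_cancel]
      _ ≤ 2 * δ + 1 := (norm_add_le _ _).trans (add_le_add hwχ hp1)
      _ ≤ 2 := by linarith
  have hss : star (q * w) * (q * w) = p := by
    rw [star_mul, hws, hqs]
    calc w * q * (q * w) = w * p * (q * q) * (p * w) := by
          rw [hwp, hpw]; simp only [mul_assoc]
      _ = w * a * w := by rw [hqq, ha]; simp only [mul_assoc]
      _ = p := by rw [hwaw, hχp]
  have hsp : ‖q * w - p‖ ≤ 4 * δ := by
    have e : q * w - p = (q - p) * w + (w - p) := by rw [sub_mul, hpw]; abel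
    rw [e]
    calc _ ≤ ‖q - p‖ * ‖w‖ + ‖w - p‖ := (norm_add_le _ _).trans (by gcongr; exact norm_mul_le _ _)
      _ ≤ δ * 2 + 2 * δ := by gcongr
      _ = 4 * δ := by ring
  refine ⟨q * w, hss, ?_, hsp⟩
  set s := q * w with hs
  have hs1 : ‖s‖ ≤ 1 := by
    have := CStarRing.norm_star_mul_self (x := s)
    rw [hss] at this
    nlinarith [norm_nonneg s]
  have hproj : IsStarProjection (s * star s) := by
    refine ⟨?_, IsSelfAdjoint.mul_star_self s⟩
    have : s * p = s := by rw [hs, mul_assoc, hwp]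
    calc s * star s * (s * star s) = s * (star s * s) * star s := by simp only [mul_assoc]
      _ = s * star s := by rw [hss, this]
  refine (hq.eq_of_mul_eq_right hproj ?_ ?_).symm
  · rw [← mul_assoc, hs, ← mul_assoc, hqq]
  · have e : q - s * star s = (q - p) - ((s - p) * star s + p * star (s - p)) := by
      rw [star_sub, hps, sub_mul, mul_sub, hpp]; abel
    rw [e]
    calc _ ≤ ‖q - p‖ + (‖s - p‖ * ‖star s‖ + ‖p‖ * ‖star (s - p)‖) :=
          (norm_sub_le _ _).trans (add_le_add le_rfl ((norm_add_le _ _).trans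
            (add_le_add (norm_mul_le _ _) (norm_mul_le _ _))))
      _ ≤ δ + (4 * δ * 1 + 1 * (4 * δ)) := by
          rw [norm_star, norm_star]; gcongr
      _ < 1 := by linarith

end Projections

/-! ### Simple C*-algebras -/

section Simple

variable {A : Type*} [NonUnitalCStarAlgebra A]

/-- A simple C*-algebra is prime: the elements annihilated by `a A` from the left form a closed
two-sided ideal. -/
theorem IsSimpleCStar.exists_mul_mul_ne_zero (hA : IsSimpleCStar A) {a b : A} (ha : a ≠ 0)
    (hb : b ≠ 0) : ∃ d : A, a * d * b ≠ 0 := by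
  by_contra! hab
  let I : TwoSidedIdeal A := TwoSidedIdeal.mk' {t | ∀ d, a * d * t = 0} (by simp)
    (fun hx hy d => by rw [mul_add, hx d, hy d, add_zero])
    (fun hx d => by rw [mul_neg, hx d, neg_zero])
    (fun {x y} hy d => by rw [← mul_assoc, mul_assoc a d x, hy])
    (fun {x y} hx d => by rw [← mul_assoc, hx d, zero_mul])
  have hI : ∀ t, t ∈ I ↔ ∀ d, a * d * t = 0 := fun t => TwoSidedIdeal.mem_mk' ..
  have hclosed : IsClosed (I : Set A) := by
    have : (I : Set A) = ⋂ d : A, {t | a * d * t = 0} := by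
      ext t; simpa using hI t
    rw [this]
    exact isClosed_iInter fun d => isClosed_eq (by fun_prop) continuous_const
  rcases hA.2 I hclosed with h | h
  · have : b ∈ I := (hI b).2 hab
    rw [h] at this
    exact hb this
  · have h1 : a * star a ∈ I := by rw [h]; trivial
    have h2 := (hI _).1 h1 (star a)
    have h3 : star (a * star a) * (a * star a) = 0 := by
      rw [star_mul, star_star]; exact h2
    rw [CStarRing.star_mul_self_eq_zero_iff, CStarRing.mul_star_self_eq_zero_iff] at h3
    exact ha h3

theorem CuntzLE.smul_left {a b : A} (h : CuntzLE a b) {r : ℝ} (hr : 0 ≤ r) :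
    CuntzLE (r • a) b := by
  obtain ⟨v, hv⟩ := h
  refine ⟨fun n => √r • v n, ?_⟩
  have : ∀ n, √r • v n * b * star (√r • v n) = r • (v n * b * star (v n)) := fun n => by
    rw [star_smul, star_trivial, smul_mul_assoc, smul_mul_assoc, mul_smul_comm, smul_smul,
      Real.mul_self_sqrt hr]
  simp only [this]
  exact hv.const_smul r

variable [PartialOrder A] [StarOrderedRing A]

/-- In a simple C*-algebra two nonzero positive elements dominate a common nonzero positive
element. If `x = √a d √b ≠ 0`, then `(x x*)²` is of the form `w a w*` and is dominated by a
multiple of `x x*`, which is of the form `w b w*`. -/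
theorem IsSimpleCStar.exists_common_cuntzLE (hA : IsSimpleCStar A) {a b : A} (ha : 0 ≤ a)
    (hb : 0 ≤ b) (ha0 : a ≠ 0) (hb0 : b ≠ 0) :
    ∃ c : A, 0 ≤ c ∧ ‖c‖ = 1 ∧ CuntzLE c a ∧ CuntzLE c b := by
  obtain ⟨r, hr, rfl⟩ : ∃ r : A, star r = r ∧ r * r = a :=
    ⟨CFC.sqrt a, (CFC.sqrt_nonneg a).isSelfAdjoint.star_eq, CFC.sqrt_mul_sqrt_self a ha⟩
  obtain ⟨s, hs, rfl⟩ : ∃ s : A, star s = s ∧ s * s = b :=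
    ⟨CFC.sqrt b, (CFC.sqrt_nonneg b).isSelfAdjoint.star_eq, CFC.sqrt_mul_sqrt_self b hb⟩
  obtain ⟨d, hd⟩ := hA.exists_mul_mul_ne_zero (left_ne_zero_of_mul ha0) (left_ne_zero_of_mul hb0)
  set x := r * d * s with hx
  have hxs : star x = s * star d * r := by
    rw [hx, star_mul, star_mul, hr, hs, mul_assoc]
  set c := x * star x * (x * star x) with hc
  have hc0 : 0 ≤ c := by
    have : c = star (x * star x) * (x * star x) := by rw [star_mul, star_star]
    rw [this]; exact star_mul_self_nonneg _
  have hcne : c ≠ 0 := by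
    intro h
    have : star (x * star x) * (x * star x) = 0 := by rw [star_mul, star_star]; exact h
    rw [CStarRing.star_mul_self_eq_zero_iff, CStarRing.mul_star_self_eq_zero_iff] at this
    exact hd this
  have hca : CuntzLE c (r * r) := by
    have : c = (x * (s * star d)) * (r * r) * star (x * (s * star d)) := by
      have : star (x * (s * star d)) = d * s * star x := by
        rw [star_mul, star_mul, star_star, hs]
      rw [this, hc]
      calc x * star x * (x * star x) = x * (s * star d * r) * (r * d * s * star x) := by
            rw [← hxs, ← hx]
        _ = _ := by simp only [mul_assoc]
    rw [this]; exact CuntzLE.conj _ _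
  have hcb : CuntzLE c (s * s) := by
    have hle : c ≤ ‖star x * x‖ • (x * star x) := by
      have := CStarAlgebra.star_right_conjugate_le_norm_smul (a := x) (b := star x * x)
        (IsSelfAdjoint.star_mul_self x)
      rwa [← mul_assoc, mul_assoc (x * star x)] at this
    have hxb : CuntzLE (x * star x) (s * s) := by
      have : x * star x = (r * d) * (s * s) * star (r * d) := by
        rw [hxs, star_mul, hr, hx]; simp only [mul_assoc]
      rw [this]; exact CuntzLE.conj _ _
    exact (cuntzLE_of_le hc0 hle).trans (hxb.smul_left (norm_nonneg _))
  have hn : 0 < ‖c‖ := norm_pos_iff.2 hcne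
  refine ⟨‖c‖⁻¹ • c, smul_nonneg (by positivity) hc0, ?_, hca.smul_left (by positivity),
    hcb.smul_left (by positivity)⟩
  rw [norm_smul, norm_inv, norm_norm, inv_mul_cancel₀ hn.ne']

end Simple

/-! ### Rokhlin frames -/

section RokhlinFrames

variable {A : Type*} [NonUnitalCStarAlgebra A]

theorem mul_star_mul_self_of_isStarProjection {t : A} (h : IsStarProjection (star t * t)) :
    t * star t * t = t := by
  rw [← sub_eq_zero, ← CStarRing.star_mul_self_eq_zero_iff]
  have h1 := h.isIdempotentElem.eq
  have e : star (t * star t * t - t) * (t * star t * t - t) =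
      star t * t * (star t * t) * (star t * t) - star t * t * (star t * t)
        - star t * t * (star t * t) + star t * t := by
    simp only [star_sub, star_mul, star_star]; noncomm_ring
  rw [e, h1, h1]; abel

theorem norm_le_one_of_star_mul_self {t : A} (h : IsStarProjection (star t * t)) : ‖t‖ ≤ 1 := by
  have h1 := CStarRing.norm_star_mul_self (x := t)
  have h2 := h.norm_le_one
  nlinarith [norm_nonneg t]

variable {G : Type*} [Group G]

theorem norm_action (α : G →* (A ≃⋆ₐ[ℂ] A)) (g : G) (a : A) : ‖α g a‖ = ‖a‖ :=
  NonUnitalStarAlgHom.norm_map (α g) (α g).injective a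

theorem action_action (α : G →* (A ≃⋆ₐ[ℂ] A)) (g h : G) (a : A) :
    α g (α h a) = α (g * h) a := by
  rw [map_mul]; rfl

theorem IsStarProjection.action {p : A} (hp : IsStarProjection p) (α : G →* (A ≃⋆ₐ[ℂ] A)) (g : G) :
    IsStarProjection (α g p) :=
  hp.map (α g)

variable [Fintype G]

/-- A family `t` of partial isometries, `t g` having initial projection `α_g(f)`, with mutually
orthogonal final projections that add up to `e`. In the crossed product the elements `t g u_g` then
generate a system of matrix units over the corner of `f`. -/
structure IsRokhlinFrame (α : G →* (A ≃⋆ₐ[ℂ] A)) (e f : A) (t : G → A) : Prop where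
  isStarProjection : IsStarProjection f
  one : t 1 = f
  star_mul_self : ∀ g, star (t g) * t g = α g f
  star_mul_eq_zero : ∀ g h, g ≠ h → star (t g) * t h = 0
  sum_mul_star : ∑ g, t g * star (t g) = e

/-- The average over the group of a projection that is almost invariant yields an invariant
projection nearby. -/
theorem exists_invariant_projection (α : G →* (A ≃⋆ₐ[ℂ] A)) {p : A} (hp : IsStarProjection p)
    {δ : ℝ} (h : ∀ g, ‖α g p - p‖ ≤ δ) (hδ : δ ≤ 1 / 32) :
    ∃ e : A, IsStarProjection e ∧ (∀ g, α g e = e) ∧ ‖e - p‖ ≤ 9 * δ := by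
  have hn : (0 : ℝ) < Fintype.card G := by exact_mod_cast Fintype.card_pos
  set c : ℂ := (((Fintype.card G : ℝ)⁻¹ : ℝ) : ℂ) with hc
  set q : A := c • ∑ g, α g p with hq
  have hcs : star c = c := by rw [hc]; exact Complex.conj_ofReal _
  have hqs : IsSelfAdjoint q := by
    rw [IsSelfAdjoint, hq, star_smul, star_sum, hcs]
    simp only [← map_star, hp.isSelfAdjoint.star_eq]
  have hqα : ∀ g, α g q = q := by
    intro g
    rw [hq, map_smul, map_sum]
    simp only [action_action]
    congr 1
    exact Fintype.sum_equiv (Equiv.mulLeft g) _ _ fun _ => rfl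
  have hqp : ‖q - p‖ ≤ δ := by
    have hcc : c * (Fintype.card G : ℂ) = 1 := by
      rw [hc]; push_cast
      exact inv_mul_cancel₀ (by exact_mod_cast hn.ne')
    have e : q - p = c • ∑ g, (α g p - p) := by
      rw [Finset.sum_sub_distrib, smul_sub, Finset.sum_const, Finset.card_univ,
        ← Nat.cast_smul_eq_nsmul ℂ, smul_smul, hcc, one_smul]
    have hnc : ‖c‖ = (Fintype.card G : ℝ)⁻¹ := by
      rw [hc, Complex.norm_real, Real.norm_eq_abs, abs_of_pos (inv_pos.2 hn)]
    rw [e, norm_smul, hnc]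
    calc _ ≤ (Fintype.card G : ℝ)⁻¹ * (Fintype.card G * δ) := by
          gcongr
          refine (norm_sum_le_of_le _ fun g _ => h g).trans ?_
          simp
      _ = δ := by field_simp
  have hqq := norm_mul_self_sub_le hp hqp (by linarith)
  have hqq' : ‖q * q - q‖ ≤ 3 / 16 := hqq.trans (by linarith)
  refine ⟨cfcₙ ramp q, isStarProjection_cfcₙ_ramp hqs hqq', fun g => ?_, ?_⟩
  · have := NonUnitalStarAlgHomClass.map_cfcₙ (S := ℂ) (α g) ramp q (by fun_prop) ramp_zero
      (NonUnitalStarAlgHom.isometry (α g) (α g).injective).continuous hqs (by rwa [hqα])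
    rw [this, hqα]
  · calc _ ≤ ‖cfcₙ ramp q - q‖ + ‖q - p‖ := norm_sub_le_norm_sub_add_norm_sub _ _ _
      _ ≤ 8 * δ + δ := add_le_add ((norm_cfcₙ_ramp_sub_le hqs hqq').trans (by linarith)) hqp
      _ = 9 * δ := by ring

theorem isStarProjection_sum {ι : Type*} [Fintype ι] {p : ι → A} (hp : ∀ g, IsStarProjection (p g))
    (ho : ∀ g h, g ≠ h → p g * p h = 0) : IsStarProjection (∑ g, p g) where
  isIdempotentElem := by
    classical
    rw [IsIdempotentElem, Finset.sum_mul_sum]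
    refine Finset.sum_congr rfl fun g _ => ?_
    rw [Finset.sum_eq_single g (fun h _ hh => ho g h hh.symm) (by simp)]
    exact (hp g).isIdempotentElem.eq
  isSelfAdjoint := by
    rw [IsSelfAdjoint, star_sum]
    exact Finset.sum_congr rfl fun g _ => (hp g).isSelfAdjoint.star_eq

theorem norm_sum_action_sub_le (α : G →* (A ≃⋆ₐ[ℂ] A)) {p : G → A} {η : ℝ}
    (h : ∀ g h, ‖α g (p h) - p (g * h)‖ ≤ η) (g : G) :
    ‖α g (∑ h, p h) - ∑ h, p h‖ ≤ Fintype.card G * η := by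
  have e : ∑ h, p h = ∑ h, p (g * h) := (Fintype.sum_equiv (Equiv.mulLeft g) _ _ fun _ => rfl).symm
  nth_rw 2 [e]
  rw [map_sum, ← Finset.sum_sub_distrib]
  refine (norm_sum_le_of_le _ fun k _ => h g k).trans ?_
  simp

theorem norm_mul_mul_sub_le (x x' a y y' : A) :
    ‖x * a * y - x' * a * y'‖ ≤ ‖x - x'‖ * ‖a‖ * ‖y‖ + ‖x'‖ * ‖a‖ * ‖y - y'‖ := by
  have e : x * a * y - x' * a * y' = (x - x') * a * y + x' * a * (y - y') := by noncomm_ring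
  rw [e]
  refine (norm_add_le _ _).trans (add_le_add ?_ ?_) <;>
    exact (norm_mul_le _ _).trans (by gcongr; exact norm_mul_le _ _)

/-- Almost equivariant orthogonal projections can be perturbed to a Rokhlin frame over an
invariant projection. -/
theorem exists_isRokhlinFrame (α : G →* (A ≃⋆ₐ[ℂ] A)) {p : G → A}
    (hp : ∀ g, IsStarProjection (p g)) (ho : ∀ g h, g ≠ h → p g * p h = 0) {η : ℝ}
    (h : ∀ g h, ‖α g (p h) - p (g * h)‖ ≤ η) (hη : Fintype.card G * η ≤ 1 / 4000) :
    ∃ (e f : A) (t : G → A), IsRokhlinFrame α e f t ∧ IsStarProjection e ∧ (∀ g, α g e = e) ∧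
      ‖e - ∑ g, p g‖ ≤ 9 * (Fintype.card G * η) ∧
      (∀ g, ‖t g - α g f‖ ≤ 720 * (Fintype.card G * η)) ∧
      ∀ g, ‖t g - p g‖ ≤ 828 * (Fintype.card G * η) := by
  classical
  set P := ∑ g, p g with hP
  set κ := Fintype.card G * η with hκ
  have hη0 : 0 ≤ η := (norm_nonneg _).trans (h 1 1)
  have hn : (1 : ℝ) ≤ Fintype.card G := by exact_mod_cast Fintype.card_pos
  have hηκ : η ≤ κ := by nlinarith
  have hPP : IsStarProjection P := isStarProjection_sum hp ho
  obtain ⟨e, he, heα, heP⟩ := exists_invariant_projection α hPP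
    (norm_sum_action_sub_le α h) (by linarith)
  obtain ⟨s, hss, hss', hsP⟩ := hPP.exists_partialIsometry he heP (by linarith)
  have hPp : ∀ g, P * p g = p g := fun g => by
    rw [hP, Finset.sum_mul, Finset.sum_eq_single g (fun k _ hk => ho k g hk) (by simp)]
    exact (hp g).isIdempotentElem.eq
  have hpP : ∀ g, p g * P = p g := fun g => by
    simpa [(hp g).isSelfAdjoint.star_eq, hPP.isSelfAdjoint.star_eq] using congrArg star (hPp g)
  have hs1 : ‖s‖ ≤ 1 := norm_le_one_of_star_mul_self (by rwa [hss])
  -- conjugation by `s` moves the `p g` to orthogonal projections with sum `e`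
  let q : G → A := fun g => s * p g * star s
  have hqq : ∀ g k, q g * q k = s * (p g * p k) * star s := fun g k => by
    calc q g * q k = s * p g * (star s * s) * p k * star s := by simp only [q, mul_assoc]
      _ = _ := by rw [hss, mul_assoc s (p g) P, hpP]; simp only [mul_assoc]
  have hq : ∀ g, IsStarProjection (q g) := fun g =>
    { isIdempotentElem := by rw [IsIdempotentElem, hqq, (hp g).isIdempotentElem.eq]
      isSelfAdjoint := by
        simp only [q, IsSelfAdjoint, star_mul, star_star, (hp g).isSelfAdjoint.star_eq, mul_assoc] }
  have hqo : ∀ g k, g ≠ k → q g * q k = 0 := fun g k hgk => by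
    rw [hqq, ho g k hgk, mul_zero, zero_mul]
  have hqsum : ∑ g, q g = e := by
    simp only [q]
    rw [← Finset.sum_mul, ← Finset.mul_sum, ← hss', ← hP, ← hss, ← mul_assoc,
      mul_star_mul_self_of_isStarProjection (by rwa [hss])]
  have hqp : ∀ g, ‖q g - p g‖ ≤ 72 * κ := fun g => by
    have e1 : q g - p g = s * p g * star s - P * p g * star P := by
      rw [hPP.isSelfAdjoint.star_eq, hPp, hpP]
    rw [e1]
    refine (norm_mul_mul_sub_le _ _ _ _ _).trans ?_
    rw [← star_sub, norm_star, norm_star]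
    calc _ ≤ (4 * (9 * κ)) * 1 * 1 + 1 * 1 * (4 * (9 * κ)) := by
          have := (hp g).norm_le_one
          have := hPP.norm_le_one
          gcongr
      _ = 72 * κ := by ring
  have hαf : ∀ g, ‖α g (q 1) - p g‖ ≤ 73 * κ := fun g => by
    have h1 := h g 1
    rw [mul_one] at h1
    calc _ ≤ ‖α g (q 1) - α g (p 1)‖ + ‖α g (p 1) - p g‖ := norm_sub_le_norm_sub_add_norm_sub _ _ _
      _ ≤ 72 * κ + η := by
          rw [← map_sub, norm_action]
          exact add_le_add (hqp 1) h1
      _ ≤ 73 * κ := by linarith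
  have hex : ∀ g, ∃ t : A, (g = 1 → t = q 1) ∧ star t * t = α g (q 1) ∧ t * star t = q g ∧
      ‖t - α g (q 1)‖ ≤ 720 * κ := by
    intro g
    -- at the identity the choice `t = q 1` is forced by the definition of a frame
    by_cases hg : g = 1
    · subst hg
      have h1 := (hq 1).isSelfAdjoint.star_eq
      have h2 := (hq 1).isIdempotentElem.eq
      refine ⟨q 1, fun _ => rfl, ?_, ?_, ?_⟩
      · rw [h1, h2, map_one]; rfl
      · rw [h1, h2]
      · rw [map_one]
        change ‖q 1 - q 1‖ ≤ _
        rw [sub_self, norm_zero]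
        linarith
    · obtain ⟨t, ht1, ht2, ht3⟩ := ((hq 1).action α g).exists_partialIsometry (hq g)
        (δ := 180 * κ) (by
          calc _ ≤ ‖q g - p g‖ + ‖p g - α g (q 1)‖ := norm_sub_le_norm_sub_add_norm_sub _ _ _
            _ ≤ 72 * κ + 73 * κ := by rw [norm_sub_rev (p g)]; exact add_le_add (hqp g) (hαf g)
            _ ≤ 180 * κ := by linarith) (by linarith)
      exact ⟨t, fun h => absurd h hg, ht1, ht2, by linarith⟩
  choose t ht1 htα htq htn using hex
  refine ⟨e, q 1, t, ⟨hq 1, ht1 1 rfl, htα, fun g k hgk => ?_, ?_⟩, he, heα, heP, htn, fun g => ?_⟩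
  · have hg := mul_star_mul_self_of_isStarProjection (t := t g)
      (by rw [htα]; exact (hq 1).action α g)
    have hk := mul_star_mul_self_of_isStarProjection (t := t k)
      (by rw [htα]; exact (hq 1).action α k)
    rw [← hg, ← hk, star_mul, star_mul, star_star]
    calc star (t g) * (t g * star (t g)) * (t k * star (t k) * t k)
        = star (t g) * ((t g * star (t g)) * (t k * star (t k))) * t k := by simp only [mul_assoc]
      _ = 0 := by rw [htq, htq, hqo g k hgk, mul_zero, zero_mul]
  · rw [← hqsum]; exact Finset.sum_congr rfl fun g _ => htq g
  · calc _ ≤ ‖t g - α g (q 1)‖ + ‖α g (q 1) - p g‖ := norm_sub_le_norm_sub_add_norm_sub _ _ _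
      _ ≤ 720 * κ + 73 * κ := add_le_add (htn g) (hαf g)
      _ ≤ 828 * κ := by linarith

theorem IsRokhlinFrame.norm_le_one {α : G →* (A ≃⋆ₐ[ℂ] A)} {e f : A} {t : G → A}
    (ht : IsRokhlinFrame α e f t) (g : G) : ‖t g‖ ≤ 1 :=
  norm_le_one_of_star_mul_self (by
    rw [ht.star_mul_self]; exact ht.isStarProjection.action α g)

theorem norm_commutator_le {e p : A} (a : A) :
    ‖e * a - a * e‖ ≤ 2 * ‖e - p‖ * ‖a‖ + ‖p * a - a * p‖ := by
  have e1 : e * a - a * e = (e - p) * a - a * (e - p) + (p * a - a * p) := by noncomm_ring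
  rw [e1]
  refine (norm_add_le _ _).trans (add_le_add ((norm_sub_le _ _).trans ?_) le_rfl)
  have h1 := norm_mul_le (e - p) a
  have h2 := norm_mul_le a (e - p)
  linarith

/-- The tracial Rokhlin property with exact equivariance: the Rokhlin projections are replaced by a
Rokhlin frame over an invariant projection `e`. The estimate on `t_g* a α_k(t_h)` expresses that
`p_g a p_{kh}` almost vanishes for `g ≠ kh`. -/
theorem TracialRokhlin.exists_isRokhlinFrame [PartialOrder A] {α : G →* (A ≃⋆ₐ[ℂ] A)}
    (hα : TracialRokhlin α) (F : Finset A) {δ : ℝ} (hδ : 0 < δ) {x y : A} (hx : 0 ≤ x)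
    (hy : 0 ≤ y) (hx1 : ‖x‖ = 1) :
    ∃ (e f : A) (t : G → A), IsRokhlinFrame α e f t ∧ IsStarProjection e ∧ (∀ g, α g e = e) ∧
      (∀ g, ‖t g - α g f‖ ≤ δ) ∧ (∀ a ∈ F, ‖e * a - a * e‖ ≤ δ) ∧
      (∀ a ∈ F, ∀ g h k, k * h ≠ g → ‖star (t g) * a * α k (t h)‖ ≤ δ) ∧
      ∃ (p : A) (η : ℝ), IsStarProjection p ∧ ‖e - p‖ ≤ δ ∧ 0 < η ∧ η ≤ δ ∧
        CuntzLE (cutDown (y * y - y * p * y) η) x ∧ 1 - δ < ‖p * x * p‖ := by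
  have hn : (1 : ℝ) ≤ Fintype.card G := by exact_mod_cast Fintype.card_pos
  set M : ℝ := 1 + ∑ a ∈ F, ‖a‖ with hM
  have hFM : ∀ a ∈ F, ‖a‖ ≤ M := fun a ha => by
    have := Finset.single_le_sum (f := fun a : A => ‖a‖) (fun _ _ => norm_nonneg _) ha
    linarith
  have hM1 : 1 ≤ M := by
    have := Finset.sum_nonneg (s := F) fun a _ => norm_nonneg a
    linarith
  set μ := min δ 1 with hμ
  have hμ0 : 0 < μ := lt_min hδ one_pos
  have hμ1 : μ ≤ 1 := min_le_right _ _
  have hμδ : μ ≤ δ := min_le_left _ _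
  set η := μ / (4000 * Fintype.card G * M) with hη
  have hη0 : 0 < η := by positivity
  obtain ⟨p, hp, ho, hc, hα', hy', hx'⟩ := hα F η hη0 x y hx hy hx1
  set κ := Fintype.card G * η with hκ
  have hκM : κ * M = μ / 4000 := by rw [hκ, hη]; field_simp
  have hκ0 : 0 ≤ κ := by positivity
  have hκ1 : κ ≤ μ / 4000 := by rw [← hκM]; nlinarith
  have hηκ : η ≤ κ := by nlinarith
  obtain ⟨e, f, t, ht, he, heα, hep, htf, htp⟩ := _root_.exists_isRokhlinFrame α hp ho
    (fun g h => (hα' g h).le) (by linarith)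
  refine ⟨e, f, t, ht, he, heα, fun g => (htf g).trans (by linarith), fun a ha => ?_,
    fun a ha g h k hg => ?_, ∑ g, p g, η, isStarProjection_sum hp ho, hep.trans (by linarith),
    hη0, by linarith, hy', by linarith⟩
  · refine (norm_commutator_le (p := ∑ g, p g) a).trans ?_
    have h1 : ‖(∑ g, p g) * a - a * ∑ g, p g‖ ≤ κ := by
      rw [Finset.sum_mul, Finset.mul_sum, ← Finset.sum_sub_distrib]
      refine (norm_sum_le_of_le _ fun g _ => (hc a ha g).le).trans ?_
      simp [hκ]
    calc _ ≤ 2 * (9 * κ) * M + κ := by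
          gcongr
          exact hFM a ha
      _ ≤ δ := by nlinarith
  · have h1 : ‖α k (t h) - p (k * h)‖ ≤ 829 * κ := by
      calc _ ≤ ‖α k (t h) - α k (p h)‖ + ‖α k (p h) - p (k * h)‖ :=
            norm_sub_le_norm_sub_add_norm_sub _ _ _
        _ ≤ 828 * κ + η := by
            rw [← map_sub, norm_action]
            exact add_le_add (htp h) (hα' k h).le
        _ ≤ 829 * κ := by linarith
    have h2 : ‖p g * a * p (k * h)‖ ≤ κ := by
      have e1 : p g * a * p (k * h) = (p g * a - a * p g) * p (k * h) := by
        rw [sub_mul, mul_assoc a, ho _ _ hg.symm, mul_zero, sub_zero]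
      rw [e1]
      calc _ ≤ ‖p g * a - a * p g‖ * ‖p (k * h)‖ := norm_mul_le _ _
        _ ≤ η * 1 := by gcongr; exacts [(hc a ha g).le, (hp _).norm_le_one]
        _ ≤ κ := by linarith
    have h3 := norm_mul_mul_sub_le (star (t g)) (p g) a (α k (t h)) (p (k * h))
    have h4 : ‖star (t g) - p g‖ ≤ 828 * κ := by
      rw [← (hp g).isSelfAdjoint.star_eq, ← star_sub, norm_star]; exact htp g
    have h5 : ‖α k (t h)‖ ≤ 1 := by rw [norm_action]; exact ht.norm_le_one h
    calc _ = ‖(star (t g) * a * α k (t h) - p g * a * p (k * h)) + p g * a * p (k * h)‖ := by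
          rw [sub_add_cancel]
      _ ≤ (828 * κ * M * 1 + 1 * M * (829 * κ)) + κ := by
          refine (norm_add_le _ _).trans (add_le_add (h3.trans ?_) h2)
          have := hFM a ha
          have := (hp g).norm_le_one
          gcongr
      _ ≤ δ := by nlinarith

end RokhlinFrames

/-! ### Elements of the crossed product -/

section CrossedProductElements

namespace CrossedProduct

variable {A : Type*} [NonUnitalCStarAlgebra A] {G : Type*} [Group G]
  {α : G →* (A ≃⋆ₐ[ℂ] A)}

theorem coeff_sub (x y : CrossedProduct α) (g : G) :
    coeff (x - y) g = coeff x g - coeff y g := rfl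

theorem coeff_sum [Fintype G] {ι : Type*} (s : Finset ι) (x : ι → CrossedProduct α) (g : G) :
    coeff (∑ i ∈ s, x i) g = ∑ i ∈ s, coeff (x i) g := by
  classical
  induction s using Finset.induction_on with
  | empty => simp
  | insert i s hi ih => rw [Finset.sum_insert hi, Finset.sum_insert hi, coeff_add, ih]

/-- The canonical expectation of `x x*` is `∑ x_g x_g*`. -/
theorem coeff_mul_star_one [Fintype G] (x : CrossedProduct α) :
    coeff (x * star x) 1 = ∑ g, coeff x g * star (coeff x g) := by
  rw [coeff_mul]
  refine Finset.sum_congr rfl fun g _ => ?_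
  rw [coeff_star, action_action]
  simp

/-- The expectation of a nonzero positive element is positive and nonzero. -/
theorem coeff_one_nonneg_and_ne_zero [Fintype G] [PartialOrder A]
    [StarOrderedRing A] {x : CrossedProduct α} (hx : 0 ≤ x) (hx0 : x ≠ 0) :
    0 ≤ coeff x 1 ∧ coeff x 1 ≠ 0 := by
  obtain ⟨y, hy⟩ := CStarAlgebra.nonneg_iff_eq_star_mul_self.1 hx
  have e : coeff x 1 = ∑ g, coeff (star y) g * star (coeff (star y) g) := by
    rw [← coeff_mul_star_one, star_star, ← hy]
  have hnn : ∀ g ∈ Finset.univ, 0 ≤ coeff (star y) g * star (coeff (star y) g) :=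
    fun g _ => mul_star_self_nonneg _
  refine ⟨by rw [e]; exact Finset.sum_nonneg hnn, fun h => hx0 ?_⟩
  rw [e, Finset.sum_eq_zero_iff_of_nonneg hnn] at h
  have : star y = 0 := by
    ext g
    exact (CStarRing.mul_star_self_eq_zero_iff _).1 (h g (Finset.mem_univ g))
  rw [hy, this, zero_mul]

variable [DecidableEq G]

/-- The element `a u_g`. -/
def mono (α : G →* (A ≃⋆ₐ[ℂ] A)) (a : A) (g : G) : CrossedProduct α := mk α (Pi.single g a)

theorem coeff_mono (a : A) (g h : G) : coeff (mono α a g) h = if h = g then a else 0 := by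
  rw [mono, coeff_mk, Pi.single_apply]

theorem incl_eq_mono (a : A) : incl α a = mono α a 1 := rfl

theorem coeff_incl (a : A) (h : G) : coeff (incl α a) h = if h = 1 then a else 0 :=
  coeff_mono a 1 h

theorem star_mono (a : A) (g : G) : star (mono α a g) = mono α (α g⁻¹ (star a)) g⁻¹ := by
  ext h
  rw [coeff_star, coeff_mono, coeff_mono]
  by_cases hh : h = g⁻¹
  · subst hh; simp
  · have : h⁻¹ ≠ g := fun h' => hh (by rw [← h', inv_inv])
    simp [hh, this]

variable [Fintype G]

theorem coeff_mono_mul (a : A) (g : G) (x : CrossedProduct α) (h : G) :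
    coeff (mono α a g * x) h = a * α g (coeff x (g⁻¹ * h)) := by
  rw [coeff_mul, Finset.sum_eq_single g (fun k _ hk => by simp [coeff_mono, hk]) (by simp)]
  simp [coeff_mono]

theorem coeff_mul_mono (x : CrossedProduct α) (b : A) (g h : G) :
    coeff (x * mono α b g) h = coeff x (h * g⁻¹) * α (h * g⁻¹) b := by
  rw [coeff_mul, Finset.sum_eq_single (h * g⁻¹) (fun k _ hk => ?_) (by simp)]
  · simp [coeff_mono]
  · have : k⁻¹ * h ≠ g := fun h' => hk (by rw [← h']; group)
    simp [coeff_mono, this]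

theorem mono_mul_mono (a b : A) (g h : G) :
    mono α a g * mono α b h = mono α (a * α g b) (g * h) := by
  ext k
  rw [coeff_mono_mul, coeff_mono, coeff_mono]
  by_cases hk : k = g * h
  · subst hk; simp
  · have : g⁻¹ * k ≠ h := fun h' => hk (by rw [← h']; group)
    simp [hk, this]

theorem sum_mono (x : CrossedProduct α) : ∑ g, mono α (coeff x g) g = x := by
  ext h
  rw [coeff_sum]
  simp [coeff_mono]

theorem coeff_incl_mul (a : A) (x : CrossedProduct α) (g : G) :
    coeff (incl α a * x) g = a * coeff x g := by
  rw [incl_eq_mono, coeff_mono_mul]; simp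

theorem coeff_mul_incl (x : CrossedProduct α) (b : A) (g : G) :
    coeff (x * incl α b) g = coeff x g * α g b := by
  rw [incl_eq_mono, coeff_mul_mono]; simp

/-- The canonical inclusion of `A` in the crossed product, as a star-homomorphism. -/
def inclHom (α : G →* (A ≃⋆ₐ[ℂ] A)) : A →⋆ₙₐ[ℂ] CrossedProduct α where
  toFun := incl α
  map_smul' c a := by ext g; simp [coeff_incl]
  map_zero' := by ext g; simp [coeff_incl]
  map_add' a b := by ext g; by_cases h : g = 1 <;> simp [coeff_incl, h]
  map_mul' a b := by ext g; rw [coeff_incl_mul, coeff_incl, coeff_incl]; simp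
  map_star' a := by
    rw [incl_eq_mono, incl_eq_mono, star_mono]; simp

theorem inclHom_apply (a : A) : inclHom α a = incl α a := rfl

theorem inclHom_injective : Function.Injective (inclHom α) := fun a b h => by
  simpa [inclHom_apply, coeff_incl] using congrArg (fun x => coeff x 1) h

theorem incl_mul (a b : A) : incl α (a * b) = incl α a * incl α b := map_mul (inclHom α) a b
theorem incl_sub (a b : A) : incl α (a - b) = incl α a - incl α b := map_sub (inclHom α) a b
theorem star_incl (a : A) : star (incl α a) = incl α (star a) := (map_star (inclHom α) a).symm
theorem incl_zero : incl α 0 = 0 := map_zero (inclHom α)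
theorem incl_sum {ι : Type*} (s : Finset ι) (a : ι → A) :
    incl α (∑ i ∈ s, a i) = ∑ i ∈ s, incl α (a i) := map_sum (inclHom α) a s

theorem isStarProjection_incl {p : A} (hp : IsStarProjection p) : IsStarProjection (incl α p) :=
  hp.map (inclHom α)

variable [PartialOrder A] [StarOrderedRing A]

theorem norm_incl (a : A) : ‖incl α a‖ = ‖a‖ :=
  NonUnitalStarAlgHom.norm_map (inclHom α) inclHom_injective a

theorem incl_nonneg {a : A} (ha : 0 ≤ a) : 0 ≤ incl α a := by
  obtain ⟨b, rfl⟩ := CStarAlgebra.nonneg_iff_eq_star_mul_self.1 ha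
  rw [incl_mul, ← star_incl]
  exact star_mul_self_nonneg _

theorem isClosed_range_incl : IsClosed (Set.range (incl α)) :=
  (NonUnitalStarAlgHom.isometry (inclHom α) inclHom_injective).isClosedEmbedding.isClosed_range

theorem norm_mono_le (a : A) (g : G) : ‖mono α a g‖ ≤ ‖a‖ := by
  have h := CStarRing.norm_self_mul_star (x := mono α a g)
  have e : mono α a g * star (mono α a g) = incl α (a * star a) := by
    rw [star_mono, mono_mul_mono, action_action]
    simp [mono, incl]
  rw [e, norm_incl, CStarRing.norm_self_mul_star] at h
  nlinarith [norm_nonneg a, norm_nonneg (mono α a g)]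

theorem norm_le_sum_coeff (x : CrossedProduct α) : ‖x‖ ≤ ∑ g, ‖coeff x g‖ := by
  nth_rw 1 [← sum_mono x]
  exact norm_sum_le_of_le _ fun g _ => norm_mono_le _ _

theorem norm_le_card_mul {x : CrossedProduct α} {δ : ℝ} (h : ∀ g, ‖coeff x g‖ ≤ δ) :
    ‖x‖ ≤ Fintype.card G * δ := by
  refine (norm_le_sum_coeff x).trans ((Finset.sum_le_sum fun g _ => h g).trans ?_)
  simp

/-- Every nonzero positive element of the crossed product dominates a nonzero positive element
of `A`. Compressing `x` by a Rokhlin projection `p_g` almost annihilates the coefficients `x_h`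
with `h ≠ 1`, and for some `g` it does not annihilate the expectation of `x`. -/
theorem exists_incl_cuntzLE (hα : TracialRokhlin α) {x : CrossedProduct α} (hx : 0 ≤ x)
    (hx0 : x ≠ 0) : ∃ a : A, 0 ≤ a ∧ a ≠ 0 ∧ CuntzLE (incl α a) x := by
  classical
  obtain ⟨hc, hc0⟩ := coeff_one_nonneg_and_ne_zero hx hx0
  set c := coeff x 1 with hcdef
  have hcn : 0 < ‖c‖ := norm_pos_iff.2 hc0
  have hn : (1 : ℝ) ≤ Fintype.card G := by exact_mod_cast Fintype.card_pos
  set N : ℝ := (Fintype.card G : ℝ) with hN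
  set M : ℝ := ‖c‖ + 1 + ∑ g, ‖coeff x g‖ with hM
  have hsum0 : 0 ≤ ∑ g, ‖coeff x g‖ := Finset.sum_nonneg fun _ _ => norm_nonneg _
  have hxM : ∀ g, ‖coeff x g‖ + 1 ≤ M := fun g => by
    have := Finset.single_le_sum (f := fun g => ‖coeff x g‖) (fun _ _ => norm_nonneg _)
      (Finset.mem_univ g)
    have h0 : ‖coeff x g‖ ≤ ∑ g, ‖coeff x g‖ := this
    linarith
  have hMc : ‖c‖ ≤ M := by linarith
  have hM1 : 1 ≤ M := by linarith
  -- small enough for both the off-diagonal part and the non-equivariance to be negligible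
  set η := ‖c‖ / (8 * N ^ 2 * M) with hη
  have hη0 : 0 < η := by positivity
  have hηN : N ^ 2 * M * η = ‖c‖ / 8 := by rw [hη]; field_simp
  have hη1 : N * η * ‖c‖ ≤ ‖c‖ / 8 := by
    rw [← hηN]
    have : N * ‖c‖ ≤ N ^ 2 * M := by
      calc N * ‖c‖ ≤ N * M := by gcongr
        _ ≤ N ^ 2 * M := by gcongr; nlinarith
    nlinarith
  have hη2 : N * (M * η) ≤ ‖c‖ / (8 * N) := by
    rw [le_div_iff₀ (by positivity)]
    nlinarith
  have hquot1 : ‖c‖ / (8 * N) < ‖c‖ / (4 * N) :=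
    div_lt_div_of_pos_left hcn (by positivity) (by linarith)
  have hquot2 : ‖c‖ / (4 * N) < ‖c‖ / (2 * N) :=
    div_lt_div_of_pos_left hcn (by positivity) (by linarith)
  obtain ⟨p, hp, ho, hcomm, heq, -, hnorm⟩ := hα (Finset.univ.image (coeff x)) η hη0
    (‖c‖⁻¹ • c) 0 (smul_nonneg (by positivity) hc) le_rfl (by
      rw [norm_smul, norm_inv, norm_norm, inv_mul_cancel₀ hcn.ne'])
  have hcomm' : ∀ g h, ‖p g * coeff x h - coeff x h * p g‖ ≤ η := fun g h =>
    (hcomm _ (Finset.mem_image_of_mem _ (Finset.mem_univ h)) g).le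
  have hPcP : (1 - η) * ‖c‖ ≤ ‖(∑ g, p g) * c * ∑ g, p g‖ := by
    rw [mul_smul_comm, smul_mul_assoc, norm_smul, norm_inv, norm_norm, inv_mul_eq_div,
      lt_div_iff₀ hcn] at hnorm
    exact hnorm.le
  have hoff : ∀ g h, g ≠ h → ‖p g * c * p h‖ ≤ η := fun g h hgh => by
    have e : p g * c * p h = (p g * c - c * p g) * p h := by
      rw [sub_mul, mul_assoc c, ho g h hgh, mul_zero, sub_zero]
    rw [e]
    calc _ ≤ ‖p g * c - c * p g‖ * ‖p h‖ := norm_mul_le _ _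
      _ ≤ η * 1 := by gcongr; exacts [hcomm' g 1, (hp h).norm_le_one]
      _ = η := mul_one _
  -- otherwise `p c p`, being almost the sum of the `p_g c p_g`, would have too small a norm
  obtain ⟨g, hg⟩ : ∃ g, ‖c‖ / (2 * N) ≤ ‖p g * c * p g‖ := by
    by_contra! hlt
    have h1 : ‖(∑ g, p g) * c * ∑ g, p g‖ ≤ ∑ g : G, ∑ h : G, (‖c‖ / (2 * N) *
        (if h = g then 1 else 0) + η) := by
      rw [Finset.sum_mul, Finset.sum_mul_sum]
      refine norm_sum_le_of_le _ fun g _ => norm_sum_le_of_le _ fun h _ => ?_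
      by_cases hgh : h = g
      · subst hgh; simp only [if_true, mul_one]; linarith [hlt h]
      · simp only [hgh, if_false, mul_zero, zero_add]; exact hoff g h (Ne.symm hgh)
    have h2 : ∑ g : G, ∑ h : G, (‖c‖ / (2 * N) * (if h = g then 1 else 0) + η) =
        ‖c‖ / 2 + N ^ 2 * η := by
      simp only [Finset.sum_add_distrib, ← Finset.mul_sum, Finset.sum_ite_eq', Finset.mem_univ,
        if_true, Finset.sum_const, Finset.card_univ, nsmul_eq_mul, mul_one, ← hN]
      field_simp
    rw [h2] at h1
    have h3 : N ^ 2 * η ≤ ‖c‖ / 8 := by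
      rw [← hηN]
      have : 0 ≤ N ^ 2 * η := by positivity
      nlinarith
    have h4 : η * ‖c‖ ≤ ‖c‖ / 8 := by
      refine le_trans ?_ hη1
      gcongr
      nlinarith
    nlinarith
  set b := p g * c * p g with hb
  have hb0 : 0 ≤ b := by
    have := star_left_conjugate_nonneg hc (p g)
    rwa [(hp g).isSelfAdjoint.star_eq] at this
  have hpx0 : 0 ≤ incl α (p g) * x * incl α (p g) := by
    have := star_left_conjugate_nonneg hx (incl α (p g))
    rwa [(isStarProjection_incl (hp g)).isSelfAdjoint.star_eq] at this
  have hclose : ‖incl α b - incl α (p g) * x * incl α (p g)‖ ≤ N * (M * η) := by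
    refine norm_le_card_mul fun h => ?_
    rw [coeff_sub, coeff_mul_incl, coeff_incl_mul, coeff_incl]
    by_cases hh : h = 1
    · subst hh
      have : b - p g * coeff x 1 * α 1 (p g) = 0 := by
        rw [map_one]; exact sub_self _
      rw [if_pos rfl, this, norm_zero]
      positivity
    · rw [if_neg hh, zero_sub, norm_neg]
      have e : p g * coeff x h * α h (p g) = p g * coeff x h * (α h (p g) - p (h * g)) +
          (p g * coeff x h - coeff x h * p g) * p (h * g) := by
        have : g ≠ h * g := fun h' => hh (by simpa using h'.symm)
        rw [sub_mul, mul_assoc (coeff x h), ho _ _ this]; noncomm_ring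
      rw [e]
      calc _ ≤ ‖p g‖ * ‖coeff x h‖ * ‖α h (p g) - p (h * g)‖ +
            ‖p g * coeff x h - coeff x h * p g‖ * ‖p (h * g)‖ := by
            refine (norm_add_le _ _).trans (add_le_add ?_ (norm_mul_le _ _))
            exact (norm_mul_le _ _).trans (by gcongr; exact norm_mul_le _ _)
        _ ≤ 1 * ‖coeff x h‖ * η + η * 1 := by
            have := (hp g).norm_le_one
            have := (hp (h * g)).norm_le_one
            have := hcomm' g h
            have := (heq h g).le
            gcongr
        _ = (‖coeff x h‖ + 1) * η := by ring
        _ ≤ M * η := by gcongr; exact hxM h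
  have hcut : 0 ≤ ‖c‖ / (4 * N) := by positivity
  refine ⟨cutDown b (‖c‖ / (4 * N)), cutDown_nonneg _ _, fun h0 => ?_, ?_⟩
  · have := norm_cutDown_sub_le hb0 hcut
    rw [h0, zero_sub, norm_neg] at this
    exact absurd (hg.trans this) hquot2.not_ge
  · rw [← inclHom_apply, map_cutDown (inclHom α) hb0.isSelfAdjoint hcut]
    have h1 : CuntzLE (incl α (p g) * x * incl α (p g)) x := by
      have := CuntzLE.conj (incl α (p g)) x
      rwa [(isStarProjection_incl (hp g)).isSelfAdjoint.star_eq] at this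
    refine (cuntzLE_cutDown (incl_nonneg hb0).isSelfAdjoint hpx0 ?_).trans h1
    exact lt_of_le_of_lt (hclose.trans hη2) hquot1

end CrossedProduct

end CrossedProductElements

/-! ### Matrix units from a Rokhlin frame -/

section MatrixUnits

theorem mem_cornerAlg_iff {A : Type*} [NonUnitalCStarAlgebra A] {f : A} (hf : IsStarProjection f)
    {a : A} : a ∈ cornerAlg f hf ↔ f * a * f = a := by
  constructor
  · rintro ⟨b, rfl⟩
    have h := hf.isIdempotentElem.eq
    calc f * (f * b * f) * f = (f * f) * b * (f * f) := by simp only [mul_assoc]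
      _ = f * b * f := by rw [h]
  · intro h
    exact ⟨a, h.symm⟩

theorem coe_matrixTensor_apply {G A : Type*} [DecidableEq G] [NonUnitalCStarAlgebra A] {f : A}
    {hf : IsStarProjection f} (g h k l : G) (a : cornerAlg f hf) :
    ((matrixTensor g h a k l : cornerAlg f hf) : A) = if g = k ∧ h = l then (a : A) else 0 := by
  rw [matrixTensor, CStarMatrix.ofMatrix_apply, Matrix.single_apply]
  split_ifs <;> rfl

open CrossedProduct

namespace IsRokhlinFrame

variable {A : Type*} [NonUnitalCStarAlgebra A] {G : Type*} [Group G] [Fintype G]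
  {α : G →* (A ≃⋆ₐ[ℂ] A)} {e f : A} {t : G → A}

theorem mul_star_mul_self (ht : IsRokhlinFrame α e f t) (g : G) :
    t g * star (t g) * t g = t g :=
  mul_star_mul_self_of_isStarProjection (by
    rw [ht.star_mul_self]; exact ht.isStarProjection.action α g)

theorem isSelfAdjoint (ht : IsRokhlinFrame α e f t) : star e = e := by
  rw [← ht.sum_mul_star, star_sum]
  simp only [star_mul, star_star]

variable [DecidableEq G]

theorem star_mono_mul_mono_self (ht : IsRokhlinFrame α e f t) (g : G) :
    star (mono α (t g) g) * mono α (t g) g = incl α f := by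
  rw [star_mono, mono_mul_mono, ← map_mul, ht.star_mul_self, action_action, incl_eq_mono]
  simp

theorem star_mono_mul_mono_of_ne (ht : IsRokhlinFrame α e f t) {g h : G} (hgh : g ≠ h) :
    star (mono α (t g) g) * mono α (t h) h = 0 := by
  rw [star_mono, mono_mul_mono, ← map_mul, ht.star_mul_eq_zero g h hgh, map_zero]
  ext k; simp [coeff_mono]

theorem mono_mul_incl (ht : IsRokhlinFrame α e f t) (g : G) :
    mono α (t g) g * incl α f = mono α (t g) g := by
  rw [incl_eq_mono, mono_mul_mono, ← ht.star_mul_self, ← mul_assoc, ht.mul_star_mul_self, mul_one]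

theorem incl_mul_star_mono (ht : IsRokhlinFrame α e f t) (g : G) :
    incl α f * star (mono α (t g) g) = star (mono α (t g) g) := by
  have := congrArg star (ht.mono_mul_incl g)
  rwa [star_mul, star_incl, ht.isStarProjection.isSelfAdjoint.star_eq] at this

theorem mono_mul_star_mono (g : G) :
    mono α (t g) g * star (mono α (t g) g) = incl α (t g * star (t g)) := by
  rw [star_mono, mono_mul_mono, action_action, incl_eq_mono]
  simp

theorem sum_mono_mul_star (ht : IsRokhlinFrame α e f t) :
    ∑ g, mono α (t g) g * star (mono α (t g) g) = incl α e := by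
  simp only [mono_mul_star_mono]
  rw [← incl_sum, ht.sum_mul_star]

/-- An element of the corner of `e` is recovered from its compressions by the matrix units. -/
theorem sum_compressions (ht : IsRokhlinFrame α e f t) (d : CrossedProduct α) :
    ∑ g, ∑ h, mono α (t g) g * (star (mono α (t g) g) * d * mono α (t h) h) *
      star (mono α (t h) h) = incl α e * d * incl α e := by
  rw [← ht.sum_mono_mul_star, Finset.sum_mul, Finset.sum_mul_sum]
  refine Finset.sum_congr rfl fun g _ => Finset.sum_congr rfl fun h _ => ?_
  simp only [mul_assoc]

theorem star_mono_mul_incl (ht : IsRokhlinFrame α e f t) (g : G) :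
    star (mono α (t g) g) * incl α e = star (mono α (t g) g) := by
  rw [← ht.sum_mono_mul_star, Finset.mul_sum, Finset.sum_eq_single g, ← mul_assoc,
    ht.star_mono_mul_mono_self, ht.incl_mul_star_mono]
  · intro h _ hh
    rw [← mul_assoc, ht.star_mono_mul_mono_of_ne hh.symm, zero_mul]
  · simp

theorem incl_mul_mono (ht : IsRokhlinFrame α e f t) (g : G) :
    incl α e * mono α (t g) g = mono α (t g) g := by
  have := congrArg star (ht.star_mono_mul_incl g)
  rwa [star_mul, star_star, star_incl, ht.isSelfAdjoint] at this

theorem incl_mul_incl (ht : IsRokhlinFrame α e f t) : incl α e * incl α e = incl α e := by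
  nth_rw 2 [← ht.sum_mono_mul_star]
  rw [Finset.mul_sum]
  simp only [← mul_assoc, ht.incl_mul_mono]
  exact ht.sum_mono_mul_star

theorem incl_mul_of_corner (ht : IsRokhlinFrame α e f t) {d : CrossedProduct α}
    (hd : incl α e * d * incl α e = d) : incl α e * d = d := by
  rw [← hd, ← mul_assoc, ← mul_assoc, ht.incl_mul_incl]

theorem mul_incl_of_corner (ht : IsRokhlinFrame α e f t) {d : CrossedProduct α}
    (hd : incl α e * d * incl α e = d) : d * incl α e = d := by
  rw [← hd, mul_assoc, ht.incl_mul_incl]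

theorem corner_mul (ht : IsRokhlinFrame α e f t) {c d : CrossedProduct α}
    (hc : incl α e * c * incl α e = c) (hd : incl α e * d * incl α e = d) :
    incl α e * (c * d) * incl α e = c * d := by
  rw [← mul_assoc, ht.incl_mul_of_corner hc, mul_assoc, ht.mul_incl_of_corner hd]

/-- The element `∑ v_g m_{g,h} v_h*` attached to a matrix `m`, where `v_g = t_g u_g`. -/
def ofMatrix (α : G →* (A ≃⋆ₐ[ℂ] A)) (t : G → A) (m : G → G → A) : CrossedProduct α :=
  ∑ g, ∑ h, mono α (t g) g * incl α (m g h) * star (mono α (t h) h)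

theorem compression_ofMatrix (ht : IsRokhlinFrame α e f t) (m : G → G → A) (g h : G) :
    star (mono α (t g) g) * ofMatrix α t m * mono α (t h) h = incl α (f * m g h * f) := by
  rw [ofMatrix, Finset.mul_sum, Finset.sum_mul, Finset.sum_eq_single g, Finset.mul_sum,
    Finset.sum_mul, Finset.sum_eq_single h]
  · calc _ = (star (mono α (t g) g) * mono α (t g) g) * incl α (m g h) *
          (star (mono α (t h) h) * mono α (t h) h) := by simp only [mul_assoc]
      _ = _ := by rw [ht.star_mono_mul_mono_self, ht.star_mono_mul_mono_self, incl_mul, incl_mul]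
  · intro k _ hk
    rw [mul_assoc, mul_assoc (mono α (t g) g * _), ht.star_mono_mul_mono_of_ne hk, mul_zero,
      mul_zero]
  · simp
  · intro k _ hk
    rw [Finset.mul_sum, Finset.sum_mul]
    refine Finset.sum_eq_zero fun l _ => ?_
    rw [← mul_assoc, ← mul_assoc, ht.star_mono_mul_mono_of_ne hk.symm, zero_mul, zero_mul, zero_mul]
  · simp

/-- Elements of the corner of `e` are determined by their compressions. -/
theorem eq_of_compressions (ht : IsRokhlinFrame α e f t) {c d : CrossedProduct α}
    (hc : incl α e * c * incl α e = c) (hd : incl α e * d * incl α e = d)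
    (h : ∀ g h, star (mono α (t g) g) * c * mono α (t h) h =
      star (mono α (t g) g) * d * mono α (t h) h) : c = d := by
  rw [← hc, ← hd, ← ht.sum_compressions, ← ht.sum_compressions]
  simp only [h]

theorem corner_ofMatrix (ht : IsRokhlinFrame α e f t) (m : G → G → A) :
    incl α e * ofMatrix α t m * incl α e = ofMatrix α t m := by
  simp only [ofMatrix, Finset.mul_sum, Finset.sum_mul]
  refine Finset.sum_congr rfl fun g _ => Finset.sum_congr rfl fun h _ => ?_
  rw [← mul_assoc, ← mul_assoc, ht.incl_mul_mono, mul_assoc, ht.star_mono_mul_incl]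

theorem compression_mul (ht : IsRokhlinFrame α e f t) {c : CrossedProduct α}
    (hc : incl α e * c * incl α e = c) (d : CrossedProduct α) (g h : G) :
    star (mono α (t g) g) * (c * d) * mono α (t h) h =
      ∑ k, (star (mono α (t g) g) * c * mono α (t k) k) *
        (star (mono α (t k) k) * d * mono α (t h) h) := by
  nth_rw 1 [← ht.mul_incl_of_corner hc]
  rw [← ht.sum_mono_mul_star, Finset.mul_sum, Finset.sum_mul, Finset.mul_sum, Finset.sum_mul]
  exact Finset.sum_congr rfl fun k _ => by simp only [mul_assoc]

theorem compression_ofMatrix_coe (ht : IsRokhlinFrame α e f t)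
    (M : CStarMatrix G G (cornerAlg f ht.isStarProjection)) (g h : G) :
    star (mono α (t g) g) * ofMatrix α t (fun g h => (M g h : A)) * mono α (t h) h =
      incl α (M g h : A) := by
  rw [ht.compression_ofMatrix, (mem_cornerAlg_iff ht.isStarProjection).1 (M g h).2]

variable [PartialOrder A] [StarOrderedRing A]

/-- The C*-algebra spanned by the `v_g a v_h*` with `a ∈ f A f`, as the set of those elements of
the corner of `e` whose compressions by the `v_g` lie in `A`. -/
def subalgebra (ht : IsRokhlinFrame α e f t) : NonUnitalStarSubalgebra ℂ (CrossedProduct α) where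
  carrier := {d | incl α e * d * incl α e = d ∧ ∀ g h, star (mono α (t g) g) * d * mono α (t h) h ∈
    Set.range (incl α)}
  add_mem' := by
    rintro c d ⟨hc, hc'⟩ ⟨hd, hd'⟩
    refine ⟨by rw [mul_add, add_mul, hc, hd], fun g h => ?_⟩
    rw [mul_add, add_mul]
    obtain ⟨a, ha⟩ := hc' g h
    obtain ⟨b, hb⟩ := hd' g h
    exact ⟨a + b, by rw [← ha, ← hb]; exact map_add (inclHom α) a b⟩
  zero_mem' := ⟨by simp, fun g h => ⟨0, by rw [incl_zero]; simp⟩⟩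
  mul_mem' := by
    rintro c d ⟨hc, hc'⟩ ⟨hd, hd'⟩
    refine ⟨ht.corner_mul hc hd, fun g h => ?_⟩
    rw [ht.compression_mul hc]
    choose a ha using hc'
    choose b hb using hd'
    refine ⟨∑ k, a g k * b k h, ?_⟩
    simp only [incl_sum, incl_mul, ha, hb]
  smul_mem' := by
    rintro c d ⟨hd, hd'⟩
    refine ⟨by rw [mul_smul_comm, smul_mul_assoc, hd], fun g h => ?_⟩
    obtain ⟨a, ha⟩ := hd' g h
    rw [mul_smul_comm, smul_mul_assoc, ← ha]
    exact ⟨c • a, map_smul (inclHom α) c a⟩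
  star_mem' := by
    rintro d ⟨hd, hd'⟩
    refine ⟨?_, fun g h => ?_⟩
    · have := congrArg star hd
      rwa [star_mul, star_mul, star_incl, ht.isSelfAdjoint, ← mul_assoc] at this
    · obtain ⟨a, ha⟩ := hd' h g
      refine ⟨star a, ?_⟩
      rw [← star_incl, ha, star_mul, star_mul, star_star, mul_assoc]

theorem mem_subalgebra (ht : IsRokhlinFrame α e f t) {d : CrossedProduct α} :
    d ∈ ht.subalgebra ↔ incl α e * d * incl α e = d ∧
      ∀ g h, star (mono α (t g) g) * d * mono α (t h) h ∈ Set.range (incl α) := Iff.rfl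

theorem isClosed_subalgebra (ht : IsRokhlinFrame α e f t) :
    IsClosed (ht.subalgebra : Set (CrossedProduct α)) := by
  have : (ht.subalgebra : Set (CrossedProduct α)) =
      {d | incl α e * d * incl α e = d} ∩ ⋂ (g : G) (h : G),
        (fun d => star (mono α (t g) g) * d * mono α (t h) h) ⁻¹' Set.range (incl α) := by
    ext d
    simp only [SetLike.mem_coe, mem_subalgebra, Set.mem_inter_iff, Set.mem_iInter, Set.mem_preimage]
    rfl
  rw [this]
  exact (isClosed_eq (by fun_prop) continuous_id).inter
    (isClosed_iInter fun g => isClosed_iInter fun h => isClosed_range_incl.preimage (by fun_prop))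

theorem ofMatrix_mem_subalgebra (ht : IsRokhlinFrame α e f t) (m : G → G → A) :
    ofMatrix α t m ∈ ht.subalgebra :=
  ⟨ht.corner_ofMatrix m, fun g h => ⟨_, (ht.compression_ofMatrix m g h).symm⟩⟩

/-- The star-homomorphism `e_{g,h} ⊗ a ↦ v_g a v_h*` from `M_G(f A f)` to the crossed product. -/
def matrixHom (ht : IsRokhlinFrame α e f t) :
    CStarMatrix G G (cornerAlg f ht.isStarProjection) →⋆ₙₐ[ℂ] CrossedProduct α where
  toFun M := ofMatrix α t fun g h => (M g h : A)
  map_smul' c M := by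
    refine ht.eq_of_compressions (ht.corner_ofMatrix _) ?_ fun g h => ?_
    · rw [mul_smul_comm, smul_mul_assoc, ht.corner_ofMatrix]
    · rw [ht.compression_ofMatrix_coe, mul_smul_comm, smul_mul_assoc]
      exact (map_smul (inclHom α) c (M g h : A)).trans
        (congrArg (c • ·) (ht.compression_ofMatrix_coe M g h).symm)
  map_zero' := by
    refine ht.eq_of_compressions (ht.corner_ofMatrix _) (by simp) fun g h => ?_
    rw [ht.compression_ofMatrix_coe, mul_zero, zero_mul]
    exact incl_zero
  map_add' M N := by
    refine ht.eq_of_compressions (ht.corner_ofMatrix _) ?_ fun g h => ?_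
    · rw [mul_add, add_mul, ht.corner_ofMatrix, ht.corner_ofMatrix]
    · rw [ht.compression_ofMatrix_coe, mul_add, add_mul, ht.compression_ofMatrix_coe,
        ht.compression_ofMatrix_coe]
      exact map_add (inclHom α) (M g h : A) (N g h : A)
  map_mul' M N := by
    refine ht.eq_of_compressions (ht.corner_ofMatrix _)
      (ht.corner_mul (ht.corner_ofMatrix _) (ht.corner_ofMatrix _)) fun g h => ?_
    rw [ht.compression_ofMatrix_coe, ht.compression_mul (ht.corner_ofMatrix _)]
    simp only [ht.compression_ofMatrix_coe, ← incl_mul, ← incl_sum]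
    rw [CStarMatrix.mul_apply, AddSubmonoidClass.coe_finsetSum]
    rfl
  map_star' M := by
    refine ht.eq_of_compressions (ht.corner_ofMatrix _) ?_ fun g h => ?_
    · have := congrArg star (ht.corner_ofMatrix fun g h => (M g h : A))
      rwa [star_mul, star_mul, star_incl, ht.isSelfAdjoint, ← mul_assoc] at this
    · rw [ht.compression_ofMatrix_coe]
      have := congrArg star (ht.compression_ofMatrix_coe M h g)
      rw [star_mul, star_mul, star_star, star_incl, ← mul_assoc] at this
      exact this.symm

theorem matrixHom_apply (ht : IsRokhlinFrame α e f t)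
    (M : CStarMatrix G G (cornerAlg f ht.isStarProjection)) :
    ht.matrixHom M = ofMatrix α t fun g h => (M g h : A) := rfl

theorem matrixHom_injective (ht : IsRokhlinFrame α e f t) : Function.Injective ht.matrixHom := by
  intro M N h
  refine CStarMatrix.ext fun k l => Subtype.ext (inclHom_injective (α := α) ?_)
  rw [inclHom_apply, inclHom_apply, ← ht.compression_ofMatrix_coe M k l,
    ← ht.compression_ofMatrix_coe N k l, ← ht.matrixHom_apply, ← ht.matrixHom_apply, h]

theorem exists_matrixHom_eq (ht : IsRokhlinFrame α e f t) {d : CrossedProduct α}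
    (hd : d ∈ ht.subalgebra) : ∃ M, ht.matrixHom M = d := by
  obtain ⟨hd, hd'⟩ := hd
  choose m hm using hd'
  have hmem : ∀ g h, m g h ∈ cornerAlg f ht.isStarProjection := fun g h => by
    rw [mem_cornerAlg_iff]
    apply inclHom_injective (α := α)
    rw [inclHom_apply, inclHom_apply, incl_mul, incl_mul, hm, ← mul_assoc, ← mul_assoc,
      ht.incl_mul_star_mono, mul_assoc, ht.mono_mul_incl]
  refine ⟨CStarMatrix.ofMatrix (Matrix.of fun g h => ⟨m g h, hmem g h⟩),
    ht.eq_of_compressions (ht.corner_ofMatrix _) hd fun g h => ?_⟩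
  exact (ht.compression_ofMatrix_coe _ g h).trans (hm g h)

/-- The isomorphism of `M_G(f A f)` with the C*-algebra spanned by the `v_g a v_h*`. -/
def matrixEquiv (ht : IsRokhlinFrame α e f t) :
    CStarMatrix G G (cornerAlg f ht.isStarProjection) ≃⋆ₐ[ℂ] ht.subalgebra :=
  StarAlgEquiv.ofBijective
    (NonUnitalStarAlgHom.codRestrict ht.matrixHom ht.subalgebra
      fun M => ht.ofMatrix_mem_subalgebra _)
    ⟨fun _ _ h => ht.matrixHom_injective (congrArg Subtype.val h), fun d => by
      obtain ⟨M, hM⟩ := ht.exists_matrixHom_eq d.2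
      exact ⟨M, Subtype.ext hM⟩⟩

theorem matrixEquiv_matrixTensor (ht : IsRokhlinFrame α e f t) (g h : G)
    (a : cornerAlg f ht.isStarProjection) :
    (ht.matrixEquiv (matrixTensor g h a) : CrossedProduct α) =
      mono α (t g) g * incl α (a : A) * star (mono α (t h) h) := by
  change ofMatrix α t (fun k l => ((matrixTensor g h a k l : cornerAlg f _) : A)) = _
  simp only [coe_matrixTensor_apply, ofMatrix]
  rw [Finset.sum_eq_single g, Finset.sum_eq_single h]
  · simp
  · intro l _ hl
    rw [if_neg fun h' => hl h'.2.symm, incl_zero, mul_zero, zero_mul]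
  · simp
  · intro k _ hk
    refine Finset.sum_eq_zero fun l _ => ?_
    rw [if_neg fun h' => hk h'.1.symm, incl_zero, mul_zero, zero_mul]
  · simp

theorem matrixEquiv_matrixTensor_self (ht : IsRokhlinFrame α e f t) (g : G)
    (a : cornerAlg f ht.isStarProjection) :
    (ht.matrixEquiv (matrixTensor g g a) : CrossedProduct α) =
      incl α (t g * α g a * star (t g)) := by
  rw [ht.matrixEquiv_matrixTensor, incl_eq_mono, star_mono, mono_mul_mono, mono_mul_mono,
    mul_one, action_action, incl_eq_mono]
  simp

/-- The almost diagonal part of an element of the corner of `e`: if the compressions of `d` have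
small coefficients off `u_1`, then they may be replaced by their expectations. -/
theorem exists_mem_subalgebra_near (ht : IsRokhlinFrame α e f t) (d : CrossedProduct α) {δ : ℝ}
    (h : ∀ g h k, k * h ≠ g → ‖star (t g) * coeff d k * α k (t h)‖ ≤ δ) (hδ : 0 ≤ δ) :
    ∃ b ∈ ht.subalgebra, ‖incl α e * d * incl α e - b‖ ≤ (Fintype.card G : ℝ) ^ 3 * δ := by
  let m : G → G → CrossedProduct α := fun g h => star (mono α (t g) g) * d * mono α (t h) h
  refine ⟨ofMatrix α t fun g h => coeff (m g h) 1, ht.ofMatrix_mem_subalgebra _, ?_⟩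
  have hm : ∀ g h, ‖m g h - incl α (coeff (m g h) 1)‖ ≤ Fintype.card G * δ := fun g h' => by
    refine norm_le_card_mul fun k => ?_
    rw [coeff_sub, coeff_incl]
    by_cases hk : k = 1
    · subst hk; simpa using hδ
    · rw [if_neg hk, sub_zero]
      have hc : coeff (m g h') k = α g⁻¹ (star (t g) * coeff d (g * (k * h'⁻¹)) *
          α (g * (k * h'⁻¹)) (t h')) := by
        simp only [m]
        rw [coeff_mul_mono, star_mono, coeff_mono_mul, map_mul (α g⁻¹), map_mul (α g⁻¹),
          action_action, inv_inv, inv_mul_cancel_left]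
      rw [hc, norm_action]
      refine h _ _ _ fun h1 => hk ?_
      have : g * k = g := by rw [← mul_assoc, inv_mul_cancel_right] at h1; exact h1
      simpa using this
  have hv : ∀ g, ‖mono α (t g) g‖ ≤ 1 := fun g => (norm_mono_le _ _).trans (ht.norm_le_one g)
  rw [← ht.sum_compressions, ofMatrix, ← Finset.sum_sub_distrib]
  have : ∀ g ∈ Finset.univ, ‖(∑ h, mono α (t g) g * (m g h) * star (mono α (t h) h)) -
      ∑ h, mono α (t g) g * incl α (coeff (m g h) 1) * star (mono α (t h) h)‖ ≤
      Fintype.card G * (Fintype.card G * δ) := fun g _ => by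
    rw [← Finset.sum_sub_distrib]
    refine (norm_sum_le_of_le (n := fun _ => (Fintype.card G : ℝ) * δ) _
      fun k _ => ?_).trans (by simp)
    rw [← sub_mul, ← mul_sub]
    calc _ ≤ ‖mono α (t g) g‖ * ‖m g k - incl α (coeff (m g k) 1)‖ * ‖star (mono α (t k) k)‖ :=
          (norm_mul_le _ _).trans (by gcongr; exact norm_mul_le _ _)
      _ ≤ 1 * (Fintype.card G * δ) * 1 := by
          rw [norm_star]
          have := hv g
          have := hv k
          have := hm g k
          gcongr
      _ = _ := by ring
  refine (norm_sum_le_of_le _ this).trans (le_of_eq ?_)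
  simp only [Finset.sum_const, Finset.card_univ, nsmul_eq_mul]
  ring

end IsRokhlinFrame
end MatrixUnits

/-! ### Compressions by an almost central projection -/

section LargeCorners

variable {B : Type*} [NonUnitalCStarAlgebra B]

theorem norm_conj_sub_le (w y c : B) :
    ‖star y * c * y - star w * c * w‖ ≤ ‖w - y‖ * ‖c‖ * (‖y‖ + ‖w‖) := by
  refine (norm_mul_mul_sub_le _ _ _ _ _).trans (le_of_eq ?_)
  rw [← star_sub, norm_star, norm_star, norm_sub_rev y w]
  ring

theorem norm_conj_le (y c : B) : ‖star y * c * y‖ ≤ ‖c‖ * ‖y‖ ^ 2 := by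
  calc _ ≤ ‖star y‖ * ‖c‖ * ‖y‖ := (norm_mul_le _ _).trans (by gcongr; exact norm_mul_le _ _)
    _ = _ := by rw [norm_star]; ring

theorem norm_le_norm_corner_add {E p c : B} (hE : IsStarProjection E) (hp : IsStarProjection p) :
    ‖p * c * p‖ ≤ ‖E * c * E‖ + 2 * ‖E - p‖ * ‖c‖ := by
  have h := norm_mul_mul_sub_le p E c p E
  have h1 : ‖p * c * p - E * c * E‖ ≤ 2 * ‖E - p‖ * ‖c‖ := by
    refine h.trans ?_
    rw [norm_sub_rev p E]
    have := hE.norm_le_one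
    have := hp.norm_le_one
    calc _ ≤ ‖E - p‖ * ‖c‖ * 1 + 1 * ‖c‖ * ‖E - p‖ := by gcongr
      _ = _ := by ring
  calc ‖p * c * p‖ = ‖E * c * E + (p * c * p - E * c * E)‖ := by rw [add_sub_cancel]
    _ ≤ _ := (norm_add_le _ _).trans (by gcongr)

/-- If `E` is large on `c`, which is close to `v r² v*`, and almost commutes with `v`, then `r E`
is not small. -/
theorem norm_corner_cuntz_ge {E r v c : B} (hE : IsStarProjection E) (hr : IsSelfAdjoint r)
    (hr1 : ‖r‖ ≤ 1) (hc : ‖v * (r * r) * star v - c‖ ≤ 1 / 4) (hEc : 1 / 2 ≤ ‖E * c * E‖)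
    (hEv : ‖E * v - v * E‖ ≤ 1 / 4) : 1 / 4 ≤ ‖v‖ * ‖r * E‖ := by
  have hEs := hE.isSelfAdjoint.star_eq
  have hE1 := hE.norm_le_one
  have e1 : E * v * r * star (E * v * r) = E * (v * (r * r) * star v) * E := by
    rw [star_mul, star_mul, hEs, hr.star_eq]; simp only [mul_assoc]
  have h1 : 1 / 4 ≤ ‖E * v * r‖ ^ 2 := by
    rw [sq, ← CStarRing.norm_self_mul_star, e1]
    have h2 : ‖E * (v * (r * r) * star v - c) * E‖ ≤ 1 / 4 := by
      calc _ ≤ ‖E‖ * ‖v * (r * r) * star v - c‖ * ‖E‖ :=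
            (norm_mul_le _ _).trans (by gcongr; exact norm_mul_le _ _)
        _ ≤ 1 * (1 / 4) * 1 := by gcongr
        _ = 1 / 4 := by ring
    have h3 : E * c * E = E * (v * (r * r) * star v) * E - E * (v * (r * r) * star v - c) * E := by
      rw [mul_sub, sub_mul]; abel
    rw [h3] at hEc
    have := norm_sub_le (E * (v * (r * r) * star v) * E) (E * (v * (r * r) * star v - c) * E)
    linarith
  have h2 : 1 / 2 ≤ ‖E * v * r‖ := by nlinarith [norm_nonneg (E * v * r)]
  have e2 : E * v * r = (E * v - v * E) * r + v * (E * r) := by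
    rw [sub_mul, mul_assoc v]; abel
  have e3 : ‖E * r‖ = ‖r * E‖ := by
    rw [← norm_star, star_mul, hEs, hr.star_eq]
  have h3 : ‖E * v * r‖ ≤ 1 / 4 * 1 + ‖v‖ * ‖r * E‖ := by
    rw [e2, ← e3]
    refine (norm_add_le _ _).trans (add_le_add ((norm_mul_le _ _).trans ?_) (norm_mul_le _ _))
    gcongr
  linarith

variable [PartialOrder B] [StarOrderedRing B]

/-- On the range of the spectral cut-off `r = (z - s)₊` the element `z` is at least `s`. -/
theorem smul_cutDown_mul_cutDown_le {z : B} (hz : 0 ≤ z) {s : ℝ} (hs : 0 ≤ s) :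
    s • (cutDown z s * cutDown z s) ≤ cutDown z s * z * cutDown z s := by
  let ρ : ℝ → ℝ := fun t => max (t - s) 0
  have hρ : Continuous ρ := by fun_prop
  have hρ0 : ρ 0 = 0 := by simp [ρ, hs]
  have hid : Continuous fun t : ℝ => t := continuous_id
  have hzs := hz.isSelfAdjoint
  have i1 : ContinuousOn (fun t => ρ t * t) (quasispectrum ℝ z) := (hρ.mul hid).continuousOn
  have i2 : ContinuousOn (fun t => ρ t * ρ t) (quasispectrum ℝ z) := (hρ.mul hρ).continuousOn
  have i3 : ContinuousOn (fun t => ρ t * t * ρ t) (quasispectrum ℝ z) :=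
    ((hρ.mul hid).mul hρ).continuousOn
  have e : cutDown z s * z = cfcₙ (fun t => ρ t * t) z := by
    rw [cfcₙ_mul ρ _ z hρ.continuousOn hρ0 hid.continuousOn rfl, cfcₙ_id' ℝ z, cutDown]
  rw [← sub_nonneg, e, cutDown, ← cfcₙ_mul _ ρ z i1 (by simp) hρ.continuousOn hρ0,
    ← cfcₙ_mul ρ ρ z hρ.continuousOn hρ0 hρ.continuousOn hρ0,
    ← cfcₙ_smul s _ z i2 (by simp [hρ0]),
    ← cfcₙ_sub (fun t => ρ t * t * ρ t) (fun t => s • (ρ t * ρ t)) z i3 (by simp)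
      (i2.const_smul s) (by simp [hρ0])]
  refine cfcₙ_nonneg fun t _ => ?_
  have h : ρ t * t * ρ t - s • (ρ t * ρ t) = ρ t * ρ t * (t - s) := by
    simp only [smul_eq_mul]; ring
  rw [h]
  rcases le_total t s with ht | ht
  · simp [ρ, ht]
  · exact mul_nonneg (mul_self_nonneg _) (sub_nonneg.2 ht)

/-- If `E` almost commutes with the spectral cut-off `r = (z - s)₊`, then the norm of `E z E` is
almost `s`, with an error controlled by the norm of `r E`. -/
theorem mul_norm_sq_le_norm_corner {E z : B} (hE : IsStarProjection E) (hz : 0 ≤ z) (hz1 : ‖z‖ ≤ 1)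
    {s κ : ℝ} (hs : 0 ≤ s) (hκ : ‖E * cutDown z s - cutDown z s * E‖ ≤ κ) :
    s * ‖cutDown z s * E‖ ^ 2 ≤ ‖E * z * E‖ * ‖cutDown z s * E‖ ^ 2 + 2 * κ := by
  set r := cutDown z s with hr
  have hr0 : 0 ≤ r := cutDown_nonneg z s
  have hrs : star r = r := hr0.isSelfAdjoint.star_eq
  have hEs := hE.isSelfAdjoint.star_eq
  have hEE := hE.isIdempotentElem.eq
  have hE1 := hE.norm_le_one
  have hr1 : ‖r‖ ≤ 1 := (norm_cutDown_le hz hs).trans hz1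
  have hle : s • (star (r * E) * (r * E)) ≤ star (r * E) * z * (r * E) := by
    have := star_left_conjugate_le_conjugate (smul_cutDown_mul_cutDown_le hz hs) E
    rw [← hr, mul_smul_comm, smul_mul_assoc] at this
    rw [star_mul, hrs]
    simpa only [mul_assoc] using this
  have h1 : s * ‖r * E‖ ^ 2 ≤ ‖star (r * E) * z * (r * E)‖ := by
    have := CStarAlgebra.norm_le_norm_of_nonneg_of_le
      (smul_nonneg hs (star_mul_self_nonneg (r * E))) hle
    rwa [norm_smul, CStarRing.norm_star_mul_self, Real.norm_eq_abs, abs_of_nonneg hs, ← sq] at this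
  have h2 : ‖E * r * E - r * E‖ ≤ κ := by
    have e : E * r * E - r * E = (E * r - r * E) * E := by rw [sub_mul, mul_assoc r, hEE]
    rw [e]
    calc _ ≤ ‖E * r - r * E‖ * ‖E‖ := norm_mul_le _ _
      _ ≤ κ * 1 := by
        have := (norm_nonneg _).trans hκ
        gcongr
      _ = κ := mul_one κ
  have hrE : ‖r * E‖ ≤ 1 := (norm_mul_le _ _).trans (by nlinarith [norm_nonneg r, norm_nonneg E])
  have hErE : ‖E * r * E‖ ≤ ‖r * E‖ := by
    rw [mul_assoc]
    exact (norm_mul_le _ _).trans (by nlinarith [norm_nonneg (r * E)])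
  have h3 : ‖star (r * E) * z * (r * E) - star (E * r * E) * z * (E * r * E)‖ ≤ 2 * κ := by
    refine (norm_conj_sub_le _ _ _).trans ?_
    have h0 := (norm_nonneg _).trans hκ
    calc _ ≤ κ * 1 * (1 + 1) := by
          gcongr
          exact hErE.trans hrE
      _ = 2 * κ := by ring
  have h4 : ‖star (E * r * E) * z * (E * r * E)‖ ≤ ‖E * z * E‖ * ‖r * E‖ ^ 2 := by
    have e : star (E * r * E) * z * (E * r * E) =
        star (E * r * E) * (E * z * E) * (E * r * E) := by
      have h5 : star (E * r * E) = E * r * E := by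
        rw [star_mul, star_mul, hEs, hrs, mul_assoc]
      rw [h5]
      calc E * r * E * z * (E * r * E) = E * r * (E * E) * z * ((E * E) * r * E) := by
            rw [hEE]
        _ = _ := by simp only [mul_assoc]
    rw [e]
    refine (norm_conj_le _ _).trans ?_
    gcongr
  calc _ ≤ ‖star (r * E) * z * (r * E)‖ := h1
    _ = ‖star (E * r * E) * z * (E * r * E) +
        (star (r * E) * z * (r * E) - star (E * r * E) * z * (E * r * E))‖ := by
      rw [add_sub_cancel]
    _ ≤ _ := (norm_add_le _ _).trans (add_le_add h4 h3)

end LargeCorners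

/-! ### Approximation in the crossed product -/

section Approximation

namespace CrossedProduct

variable {A : Type*} [NonUnitalCStarAlgebra A] [PartialOrder A] [StarOrderedRing A]
  {G : Type*} [Group G] [Fintype G] [DecidableEq G] {α : G →* (A ≃⋆ₐ[ℂ] A)}

/-- An approximate unit of `A` is an approximate unit of the crossed product. -/
theorem exists_incl_mul_near (y : CrossedProduct α) {θ : ℝ} (hθ : 0 < θ) :
    ∃ u : A, 0 ≤ u ∧ ‖u‖ ≤ 1 ∧ ‖incl α u * y - y‖ ≤ θ := by
  have hn : (0 : ℝ) < Fintype.card G := by exact_mod_cast Fintype.card_pos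
  have hl := CStarAlgebra.increasingApproximateUnit A
  have := hl.neBot
  have hev : ∀ᶠ u in CStarAlgebra.approximateUnit A,
      ∀ g, ‖u * coeff y g - coeff y g‖ < θ / Fintype.card G := by
    rw [eventually_all]
    intro g
    have h := tendsto_iff_norm_sub_tendsto_zero.1 (hl.tendsto_mul_right (coeff y g))
    exact h.eventually_lt_const (by positivity)
  obtain ⟨u, hu, hu0, hu1⟩ := (hev.and (hl.eventually_nonneg.and hl.eventually_norm)).exists
  refine ⟨u, hu0, hu1, (norm_le_card_mul (δ := θ / Fintype.card G) fun g => ?_).trans (le_of_eq ?_)⟩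
  · rw [coeff_sub, coeff_incl_mul]; exact (hu g).le
  · field_simp

theorem norm_incl_commutator_le {e : A} (he : ∀ g, α g e = e) {w : CrossedProduct α} {δ : ℝ}
    (h : ∀ g, ‖e * coeff w g - coeff w g * e‖ ≤ δ) :
    ‖incl α e * w - w * incl α e‖ ≤ Fintype.card G * δ :=
  norm_le_card_mul fun g => by
    rw [coeff_sub, coeff_incl_mul, coeff_mul_incl, he]; exact h g

/-- Cuntz comparison for the complement of `e` passes from an element `u` of `A` that almost acts
as a unit on `y` to `y` itself. -/
theorem cuntzLE_cutDown_complement {e p c u : A} {x y : CrossedProduct α} {δ η θ ε : ℝ}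
    (hp : IsStarProjection p) (hep : ‖e - p‖ ≤ δ) (hη : 0 < η) (hηδ : η ≤ δ) (hy : 0 ≤ y)
    (he : IsSelfAdjoint e)
    (hu : 0 ≤ u) (hu1 : ‖u‖ ≤ 1) (huy : ‖incl α u * y - y‖ ≤ θ)
    (hc : CuntzLE (cutDown (u * u - u * p * u) η) c) (hcx : CuntzLE (incl α c) x)
    (hε : 4 * θ * ‖y‖ + 2 * δ * ‖y‖ ^ 2 < ε) :
    CuntzLE (cutDown (y * y - y * incl α e * y) ε) x := by
  have hys : star y = y := hy.isSelfAdjoint.star_eq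
  have hus : star u = u := hu.isSelfAdjoint.star_eq
  have hps := hp.isSelfAdjoint.star_eq
  have hpp := hp.isIdempotentElem.eq
  set b := u * u - u * p * u with hb
  have hb0 : 0 ≤ b := by
    have : b = star (u - p * u) * (u - p * u) := by
      rw [star_sub, star_mul, hus, hps, mul_sub, sub_mul, sub_mul, mul_assoc u p (p * u),
        ← mul_assoc p p, hpp, hb, mul_assoc]
      abel
    rw [this]; exact star_mul_self_nonneg _
  set w := incl α u * y with hw
  have hws : star w = y * incl α u := by rw [hw, star_mul, star_incl, hus, hys]
  have hwy : ‖w‖ ≤ ‖y‖ := by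
    refine (norm_mul_le _ _).trans ?_
    rw [norm_incl]
    nlinarith [norm_nonneg y]
  have hθ : 0 ≤ θ := (norm_nonneg _).trans huy
  have hδ : 0 ≤ δ := hη.le.trans hηδ
  have hd0 : 0 ≤ y * incl α (cutDown b η) * y := by
    have := star_left_conjugate_nonneg (incl_nonneg (α := α) (cutDown_nonneg b η)) y
    rwa [hys] at this
  have hesa : IsSelfAdjoint (y * y - y * incl α e * y) := by
    rw [IsSelfAdjoint, star_sub, star_mul, star_mul, star_mul, hys, star_incl, he.star_eq,
      mul_assoc]
  have hdx : CuntzLE (y * incl α (cutDown b η) * y) x := by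
    have h1 := CuntzLE.conj y (incl α (cutDown b η))
    rw [hys] at h1
    exact h1.trans ((hc.map (inclHom α)).trans hcx)
  refine (cuntzLE_cutDown hesa hd0 (lt_of_le_of_lt ?_ hε)).trans hdx
  have hE : y * incl α b * y = star w * w - star w * incl α p * w := by
    rw [hws, hw, hb, incl_sub, incl_mul, incl_mul, incl_mul]; noncomm_ring
  have e1 : y * y - y * incl α e * y - y * incl α (cutDown b η) * y =
      (star y * y - star w * w) - (star y * incl α p * y - star w * incl α p * w) -
        star y * incl α (e - p) * y - star y * incl α (cutDown b η - b) * y := by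
    have h1 : star y * incl α (cutDown b η - b) * y =
        y * incl α (cutDown b η) * y - (star w * w - star w * incl α p * w) := by
      rw [← hE, hys, incl_sub, mul_sub, sub_mul]
    rw [h1, hys, incl_sub, mul_sub, sub_mul]; abel
  have n1 : ‖star y * y - star w * w‖ ≤ 2 * θ * ‖y‖ := by
    have e2 : star y * y - star w * w = star (y - w) * y + star w * (y - w) := by
      rw [star_sub]; noncomm_ring
    rw [e2]
    calc _ ≤ ‖star (y - w)‖ * ‖y‖ + ‖star w‖ * ‖y - w‖ :=
          (norm_add_le _ _).trans (add_le_add (norm_mul_le _ _) (norm_mul_le _ _))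
      _ ≤ θ * ‖y‖ + ‖y‖ * θ := by
          rw [norm_star, norm_star, norm_sub_rev]; gcongr
      _ = 2 * θ * ‖y‖ := by ring
  have n2 : ‖star y * incl α p * y - star w * incl α p * w‖ ≤ 2 * θ * ‖y‖ := by
    refine (norm_conj_sub_le _ _ _).trans ?_
    have := hp.norm_le_one
    rw [norm_incl]
    calc _ ≤ θ * 1 * (‖y‖ + ‖y‖) := by gcongr
      _ = _ := by ring
  have n3 : ‖star y * incl α (e - p) * y‖ ≤ δ * ‖y‖ ^ 2 := by
    refine (norm_conj_le _ _).trans ?_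
    rw [norm_incl]; gcongr
  have n4 : ‖star y * incl α (cutDown b η - b) * y‖ ≤ δ * ‖y‖ ^ 2 := by
    refine (norm_conj_le _ _).trans ?_
    rw [norm_incl]
    gcongr
    exact (norm_cutDown_sub_le hb0 hη.le).trans hηδ
  rw [e1]
  calc _ ≤ ‖star y * y - star w * w‖ + ‖star y * incl α p * y - star w * incl α p * w‖ +
        ‖star y * incl α (e - p) * y‖ + ‖star y * incl α (cutDown b η - b) * y‖ :=
        (norm_sub_le _ _).trans (add_le_add ((norm_sub_le _ _).trans
          (add_le_add (norm_sub_le _ _) le_rfl)) le_rfl)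
    _ ≤ 2 * θ * ‖y‖ + 2 * θ * ‖y‖ + δ * ‖y‖ ^ 2 + δ * ‖y‖ ^ 2 := by gcongr
    _ = _ := by ring

end CrossedProduct

/-- An approximant of an element of norm at most `s` can be rescaled to have norm at most `s`. -/
theorem exists_real_smul_near {B : Type*} [NonUnitalCStarAlgebra B] {a b : B} {s δ : ℝ}
    (hδ : 0 < δ) (ha : ‖a‖ ≤ s) (hab : ‖a - b‖ ≤ δ) :
    ∃ r : ℝ, ‖r • b‖ ≤ s ∧ ‖a - r • b‖ ≤ 2 * δ := by
  have hs : 0 ≤ s := (norm_nonneg a).trans ha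
  have hb : ‖b‖ ≤ s + δ := by
    calc ‖b‖ = ‖a - (a - b)‖ := by rw [sub_sub_cancel]
      _ ≤ _ := (norm_sub_le _ _).trans (add_le_add ha hab)
  have hsδ : 0 < s + δ := by linarith
  have hr : ‖s / (s + δ)‖ = s / (s + δ) := by rw [Real.norm_eq_abs, abs_of_nonneg (by positivity)]
  refine ⟨s / (s + δ), ?_, ?_⟩
  · rw [norm_smul, hr]
    calc _ ≤ s / (s + δ) * (s + δ) := by gcongr
      _ = s := by field_simp
  · have e : a - (s / (s + δ)) • b = (a - b) + (δ / (s + δ)) • b := by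
      have : (δ / (s + δ)) = 1 - s / (s + δ) := by field_simp; ring
      rw [this, sub_smul, one_smul]; abel
    rw [e]
    calc _ ≤ ‖a - b‖ + ‖(δ / (s + δ)) • b‖ := norm_add_le _ _
      _ ≤ δ + δ / (s + δ) * (s + δ) := by
          rw [norm_smul, Real.norm_eq_abs, abs_of_nonneg (by positivity)]; gcongr
      _ = 2 * δ := by field_simp; ring

end Approximation

/-! ### Rokhlin frames in the crossed product -/

open CrossedProduct in
/-- In the crossed product of a simple C*-algebra by an action with the tracial Rokhlin property,
two nonzero positive elements dominate a common positive element of `A` of norm one. -/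
theorem exists_incl_common_cuntzLE {A : Type*} [NonUnitalCStarAlgebra A] [PartialOrder A]
    [StarOrderedRing A] {G : Type*} [Group G] [Fintype G] [DecidableEq G]
    {α : G →* (A ≃⋆ₐ[ℂ] A)} (hA : IsSimpleCStar A) (hα : TracialRokhlin α)
    {x y : CrossedProduct α} (hx : 0 ≤ x) (hy : 0 ≤ y) (hx0 : x ≠ 0) (hy0 : y ≠ 0) :
    ∃ c : A, 0 ≤ c ∧ ‖c‖ = 1 ∧ CuntzLE (incl α c) x ∧ CuntzLE (incl α c) y := by
  obtain ⟨a, ha, ha0, hax⟩ := exists_incl_cuntzLE hα hx hx0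
  obtain ⟨b, hb, hb0, hby⟩ := exists_incl_cuntzLE hα hy hy0
  obtain ⟨c, hc, hc1, hca, hcb⟩ := hA.exists_common_cuntzLE ha hb ha0 hb0
  exact ⟨c, hc, hc1, (hca.map (inclHom α)).trans hax, (hcb.map (inclHom α)).trans hby⟩

theorem IsRokhlinFrame.ne_zero {A : Type*} [NonUnitalCStarAlgebra A] {G : Type*} [Group G]
    [Fintype G] {α : G →* (A ≃⋆ₐ[ℂ] A)} {e f : A} {t : G → A} (ht : IsRokhlinFrame α e f t)
    (he : e ≠ 0) : f ≠ 0 := by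
  rintro rfl
  refine he ?_
  rw [← ht.sum_mul_star]
  refine Finset.sum_eq_zero fun g _ => ?_
  have : t g = 0 := by
    rw [← CStarRing.star_mul_self_eq_zero_iff, ht.star_mul_self, map_zero]
  rw [this, zero_mul]

open CrossedProduct in
/-- The tracial Rokhlin property seen from the crossed product: a Rokhlin frame may be chosen such
that its unit `e` almost commutes with finitely many elements of the crossed product, whose
compressions are almost diagonal, such that the complement of `e` is Cuntz small, and such that `e`
is large on a given positive element `z` of norm one. The last property is obtained from an element
`c` of `A` below both `x` and a spectral cut-off of `z`. -/
theorem TracialRokhlin.exists_isRokhlinFrame_crossedProduct {A : Type*} [NonUnitalCStarAlgebra A]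
    [PartialOrder A] [StarOrderedRing A] {G : Type*} [Group G] [Fintype G] [DecidableEq G]
    {α : G →* (A ≃⋆ₐ[ℂ] A)} (hA : IsSimpleCStar A) (hα : TracialRokhlin α)
    (F : Finset (CrossedProduct α)) {ε : ℝ} (hε : 0 < ε) (hε1 : ε ≤ 1)
    {x y z : CrossedProduct α} (hx : 0 ≤ x) (hy : 0 ≤ y) (hz : 0 ≤ z) (hx0 : x ≠ 0)
    (hz1 : ‖z‖ = 1) :
    ∃ (e f : A) (t : G → A), IsRokhlinFrame α e f t ∧ IsStarProjection e ∧ (∀ g, α g e = e) ∧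
      (∀ g, ‖t g - α g f‖ ≤ ε) ∧ (∀ a ∈ F, ‖incl α e * a - a * incl α e‖ ≤ ε) ∧
      (∀ a ∈ F, ∀ g h k, k * h ≠ g → ‖star (t g) * coeff a k * α k (t h)‖ ≤ ε) ∧
      CuntzLE (cutDown (y * y - y * incl α e * y) ε) x ∧
      1 - ε < ‖incl α e * z * incl α e‖ := by
  classical
  have hn : (1 : ℝ) ≤ Fintype.card G := by exact_mod_cast Fintype.card_pos
  set N : ℝ := (Fintype.card G : ℝ) with hN
  have hs : 0 ≤ 1 - ε / 2 := by linarith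
  set r := cutDown z (1 - ε / 2) with hr
  have hr0 : 0 ≤ r := cutDown_nonneg _ _
  have hrs : star r = r := hr0.isSelfAdjoint.star_eq
  have hr1 : ‖r‖ ≤ 1 := hz1 ▸ norm_cutDown_le hz hs
  have hrne : r ≠ 0 := by
    intro h
    have := norm_cutDown_sub_le hz hs
    rw [← hr, h, zero_sub, norm_neg, hz1] at this
    linarith
  have hrr0 : 0 ≤ r * r := by
    have := star_mul_self_nonneg r
    rwa [hrs] at this
  have hrrne : r * r ≠ 0 := by
    intro h
    exact hrne ((CStarRing.star_mul_self_eq_zero_iff r).1 (by rw [hrs]; exact h))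
  obtain ⟨c, hc0, hc1, hcx, hcr⟩ := exists_incl_common_cuntzLE hA hα hx hrr0 hx0 hrrne
  obtain ⟨v, hv⟩ := cuntzLE_iff.1 hcr (1 / 4) (by norm_num)
  obtain ⟨u, hu0, hu1, huy⟩ := exists_incl_mul_near y (θ := ε / (8 * (‖y‖ + 1))) (by positivity)
  -- a lower bound for the norm of `r e`
  set m := 1 / (4 * (‖v‖ + 1)) with hm
  have hm0 : 0 < m := by positivity
  have hm1 : m ≤ 1 / 4 := by
    apply one_div_le_one_div_of_le (by norm_num)
    linarith [norm_nonneg v]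
  -- the first bound makes the commutator of `e` with `r` negligible compared with `m ^ 2 * ε`, the
  -- second one controls the error in the comparison for `y`
  set δ := min (m ^ 2 * ε / (8 * N)) (ε / (8 * (‖y‖ + 1) ^ 2)) with hδ
  have hδ0 : 0 < δ := lt_min (by positivity) (by positivity)
  have hδN : N * δ ≤ m ^ 2 * ε / 8 := by
    calc N * δ ≤ N * (m ^ 2 * ε / (8 * N)) := by gcongr; exact min_le_left _ _
      _ = m ^ 2 * ε / 8 := by field_simp
  have hm2 : m ^ 2 ≤ 1 / 16 := by nlinarith
  have hδN' : N * δ ≤ ε / 128 := by nlinarith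
  have hδN1 : δ ≤ N * δ := by nlinarith
  have hδy : δ * (‖y‖ + 1) ^ 2 ≤ ε / 8 := by
    calc _ ≤ ε / (8 * (‖y‖ + 1) ^ 2) * (‖y‖ + 1) ^ 2 := by gcongr; exact min_le_right _ _
      _ = ε / 8 := by field_simp
  let F₀ : Finset A := (insert r (insert v F)).biUnion fun w => Finset.univ.image (coeff w)
  have hF₀ : ∀ w ∈ insert r (insert v F), ∀ g, coeff w g ∈ F₀ := fun w hw g =>
    Finset.mem_biUnion.2 ⟨w, hw, Finset.mem_image_of_mem _ (Finset.mem_univ g)⟩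
  obtain ⟨e, f, t, ht, he, heα, htf, hcomm, hdiag, p, η, hp, hep, hη0, hηδ, hcu, hpc⟩ :=
    hα.exists_isRokhlinFrame F₀ hδ0 hc0 hu0 hc1
  have hcomm' : ∀ w ∈ insert r (insert v F), ‖incl α e * w - w * incl α e‖ ≤ N * δ := fun w hw =>
    norm_incl_commutator_le heα fun g => hcomm _ (hF₀ w hw g)
  have hFmem : ∀ a ∈ F, a ∈ insert r (insert v F) := fun a ha =>
    Finset.mem_insert_of_mem (Finset.mem_insert_of_mem ha)
  have hE : IsStarProjection (incl α e) := isStarProjection_incl he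
  refine ⟨e, f, t, ht, he, heα, fun g => (htf g).trans (by linarith),
    fun a ha => (hcomm' a (hFmem a ha)).trans (by linarith),
    fun a ha g h k hk => (hdiag _ (hF₀ a (hFmem a ha) k) g h k hk).trans (by linarith), ?_, ?_⟩
  · refine cuntzLE_cutDown_complement hp hep hη0 hηδ hy he.isSelfAdjoint hu0 hu1 huy hcu hcx ?_
    have hy0 := norm_nonneg y
    have h1 : 4 * (ε / (8 * (‖y‖ + 1))) * ‖y‖ ≤ ε / 2 := by
      calc _ ≤ 4 * (ε / (8 * (‖y‖ + 1))) * (‖y‖ + 1) := by gcongr; linarith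
        _ = ε / 2 := by field_simp; norm_num
    have h2 : δ * ‖y‖ ^ 2 ≤ δ * (‖y‖ + 1) ^ 2 := by gcongr; linarith
    linarith
  · have hEc : 1 / 2 ≤ ‖incl α e * incl α c * incl α e‖ := by
      rw [← incl_mul, ← incl_mul, norm_incl]
      have := norm_le_norm_corner_add (c := c) he hp
      rw [hc1] at this
      linarith
    have hvr := norm_corner_cuntz_ge hE hr0.isSelfAdjoint hr1 hv.le hEc
      ((hcomm' v (Finset.mem_insert_of_mem (Finset.mem_insert_self _ _))).trans (by linarith))
    set k := ‖r * incl α e‖ with hk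
    have hk0 : 0 ≤ k := norm_nonneg _
    have hmk : m ≤ k := by
      rw [hm, div_le_iff₀ (by positivity)]
      linarith
    have hmk2 : m ^ 2 ≤ k ^ 2 := by gcongr
    have hzb := mul_norm_sq_le_norm_corner hE hz hz1.le hs (hcomm' r (Finset.mem_insert_self _ _))
    rw [← hr, ← hk] at hzb
    have hk2 : 0 < k ^ 2 := lt_of_lt_of_le (by positivity) hmk2
    by_contra! hle
    have h1 : ‖incl α e * z * incl α e‖ * k ^ 2 ≤ (1 - ε) * k ^ 2 := by gcongr
    have h2 : m ^ 2 * ε ≤ k ^ 2 * ε := by gcongr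
    have h3 : 0 < k ^ 2 * ε := by positivity
    linarith

theorem cutDown_anti {B : Type*} [NonUnitalCStarAlgebra B] [PartialOrder B] [StarOrderedRing B]
    {a : B} {δ ε : ℝ} (hδ : 0 ≤ δ) (h : δ ≤ ε) : cutDown a ε ≤ cutDown a δ := by
  refine cfcₙ_mono (fun t _ => max_le_max_right 0 (by linarith)) ?_ ?_ ?_ ?_
  · fun_prop
  · fun_prop
  · simp [hδ.trans h]
  · simp [hδ]

open CrossedProduct in
/-- If `d` almost commutes with the unit `e` of a Rokhlin frame and its compressions are almost
diagonal, then `e d` and `d e` are approximated by one element of the subalgebra of the frame, of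
norm at most `‖d‖`. -/
theorem IsRokhlinFrame.exists_mem_subalgebra_approx {A : Type*} [NonUnitalCStarAlgebra A]
    [PartialOrder A] [StarOrderedRing A] {G : Type*} [Group G] [Fintype G] [DecidableEq G]
    {α : G →* (A ≃⋆ₐ[ℂ] A)} {e f : A} {t : G → A} (ht : IsRokhlinFrame α e f t)
    (he : IsStarProjection e) (d : CrossedProduct α) {δ : ℝ} (hδ : 0 < δ)
    (hd : ‖incl α e * d - d * incl α e‖ ≤ δ)
    (h : ∀ g h k, k * h ≠ g → ‖star (t g) * coeff d k * α k (t h)‖ ≤ δ) :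
    ∃ b ∈ ht.subalgebra, ‖incl α e * d - b‖ ≤ 3 * (Fintype.card G : ℝ) ^ 3 * δ ∧
      ‖d * incl α e - b‖ ≤ 3 * (Fintype.card G : ℝ) ^ 3 * δ ∧ ‖b‖ ≤ ‖d‖ := by
  have hn : (1 : ℝ) ≤ Fintype.card G := by exact_mod_cast Fintype.card_pos
  have hn3 : (1 : ℝ) ≤ (Fintype.card G : ℝ) ^ 3 := one_le_pow₀ hn
  have hE : IsStarProjection (incl α e) := isStarProjection_incl he
  set E := incl α e
  have hEE := hE.isIdempotentElem.eq
  have hE1 := hE.norm_le_one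
  have hEdE : ‖E * d * E‖ ≤ ‖d‖ := by
    calc _ ≤ ‖E‖ * ‖d‖ * ‖E‖ := (norm_mul_le _ _).trans (by gcongr; exact norm_mul_le _ _)
      _ ≤ 1 * ‖d‖ * 1 := by gcongr
      _ = ‖d‖ := by ring
  obtain ⟨b₀, hb₀, hdb⟩ := ht.exists_mem_subalgebra_near d h hδ.le
  obtain ⟨r, hr, hrd⟩ := exists_real_smul_near (by positivity) hEdE hdb
  have h1 : ‖E * d - E * d * E‖ ≤ δ := by
    have e1 : E * d - E * d * E = E * (E * d - d * E) := by
      rw [mul_sub, ← mul_assoc, ← mul_assoc, hEE]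
    rw [e1]
    calc _ ≤ ‖E‖ * ‖E * d - d * E‖ := norm_mul_le _ _
      _ ≤ 1 * δ := by gcongr
      _ = δ := one_mul δ
  have h2 : ‖d * E - E * d * E‖ ≤ δ := by
    have e1 : d * E - E * d * E = (d * E - E * d) * E := by
      rw [sub_mul, mul_assoc d, hEE]
    rw [e1]
    calc _ ≤ ‖d * E - E * d‖ * ‖E‖ := norm_mul_le _ _
      _ ≤ δ * 1 := by rw [norm_sub_rev]; gcongr
      _ = δ := mul_one δ
  have h3 : δ ≤ (Fintype.card G : ℝ) ^ 3 * δ := by nlinarith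
  refine ⟨r • b₀, ?_, ?_, ?_, hr⟩
  · rw [← Complex.coe_smul]
    exact SMulMemClass.smul_mem (r : ℂ) hb₀
  · exact (norm_sub_le_norm_sub_add_norm_sub _ (E * d * E) _).trans (by linarith)
  · exact (norm_sub_le_norm_sub_add_norm_sub _ (E * d * E) _).trans (by linarith)

end

theorem mainTheorem6 {A : Type*} [NonUnitalCStarAlgebra A] [PartialOrder A] [StarOrderedRing A]
    {G : Type*} [Group G] [Fintype G] [DecidableEq G] (α : G →* (A ≃⋆ₐ[ℂ] A))
    (hA : IsSimpleCStar A) (hSP : PropertySP A) (hα : TracialRokhlin α)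
    (F : Finset (CrossedProduct α)) (ε : ℝ) (hε : 0 < ε)
    (x y z : CrossedProduct α) (hx : 0 ≤ x) (hy : 0 ≤ y) (hz : 0 ≤ z)
    (hx0 : x ≠ 0) (hz1 : ‖z‖ = 1) :
    ∃ (e f : A) (hf : IsStarProjection f) (D : NonUnitalStarSubalgebra ℂ (CrossedProduct α))
      (φ : CStarMatrix G G (cornerAlg f hf) ≃⋆ₐ[ℂ] D),
      -- `e` is a nonzero projection in the fixed point algebra, and `f` is nonzero
      IsStarProjection e ∧ (∀ g, α g e = e) ∧ e ≠ 0 ∧ f ≠ 0 ∧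
      -- `D` is a C*-subalgebra of `e (A ⋊ G) e`, with unit `e`
      IsClosed (D : Set (CrossedProduct α)) ∧
      (∀ d ∈ D, ∃ b, d = CrossedProduct.incl α e * b * CrossedProduct.incl α e) ∧
      CrossedProduct.incl α e ∈ D ∧
      -- `φ` restricts to the inclusion on the `(1, 1)` corner, and `φ (e_{g,g} ⊗ f)` lies in `A`
      (∀ a : cornerAlg f hf, (φ (matrixTensor 1 1 a) : CrossedProduct α) =
        CrossedProduct.incl α (a : A)) ∧
      (∀ g, ∃ b : A, (φ (matrixTensor g g (cornerUnit f hf)) : CrossedProduct α) =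
        CrossedProduct.incl α b) ∧
      -- `φ (e_{g,g} ⊗ a)` is close to `α_g(a)`
      (∀ g, ∀ a : cornerAlg f hf,
        ‖(φ (matrixTensor g g a) : CrossedProduct α) - CrossedProduct.incl α (α g (a : A))‖
          ≤ ε * ‖(a : A)‖) ∧
      -- `e` almost commutes with `F`, and `eF`, `Fe` are approximated from `D` with norm control
      (∀ a ∈ F, ‖CrossedProduct.incl α e * a - a * CrossedProduct.incl α e‖ < ε ∧
        ∃ b₁ ∈ D, ∃ b₂ ∈ D, ‖CrossedProduct.incl α e * a - b₁‖ < ε ∧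
          ‖a * CrossedProduct.incl α e - b₂‖ < ε ∧ ‖b₁‖ ≤ ‖a‖ ∧ ‖b₂‖ ≤ ‖a‖) ∧
      -- the diagonal projections add up to `e`
      (∑ g, (φ (matrixTensor g g (cornerUnit f hf)) : CrossedProduct α)) =
        CrossedProduct.incl α e ∧
      -- the complement of `e` is small
      CuntzLE (cutDown (y * y - y * CrossedProduct.incl α e * y) ε) x ∧
      -- `e` is large on `z`
      1 - ε < ‖CrossedProduct.incl α e * z * CrossedProduct.incl α e‖ := by
  have hn : (1 : ℝ) ≤ Fintype.card G := by exact_mod_cast Fintype.card_pos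
  have hn3 : (1 : ℝ) ≤ (Fintype.card G : ℝ) ^ 3 := one_le_pow₀ hn
  set δ := min ε 1 / (4 * (Fintype.card G : ℝ) ^ 3) with hδ
  have hμ : 0 < min ε 1 := lt_min hε one_pos
  have hδ0 : 0 < δ := by positivity
  have hδ3 : 4 * (Fintype.card G : ℝ) ^ 3 * δ = min ε 1 := by rw [hδ]; field_simp
  have hμε : min ε 1 ≤ ε := min_le_left _ _
  have hμ1 : min ε 1 ≤ 1 := min_le_right _ _
  have hδμ : 4 * δ ≤ min ε 1 := by nlinarith
  obtain ⟨e, f, t, ht, he, heα, htf, hcomm, hdiag, hcut, hlarge⟩ :=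
    hα.exists_isRokhlinFrame_crossedProduct hA F hδ0 (by linarith) hx hy hz hx0 hz1
  have he0 : e ≠ 0 := by
    rintro rfl
    rw [CrossedProduct.incl_zero, zero_mul, zero_mul, norm_zero] at hlarge
    linarith
  have hgg : ∀ g, (ht.matrixEquiv (matrixTensor g g (cornerUnit f ht.isStarProjection)) :
      CrossedProduct α) = CrossedProduct.incl α (t g * star (t g)) := fun g => by
    rw [ht.matrixEquiv_matrixTensor_self]
    change CrossedProduct.incl α (t g * α g f * star (t g)) = _
    rw [← ht.star_mul_self, ← mul_assoc, ht.mul_star_mul_self]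
  have hsum : (∑ g, (ht.matrixEquiv (matrixTensor g g (cornerUnit f ht.isStarProjection)) :
      CrossedProduct α)) = CrossedProduct.incl α e := by
    simp only [hgg]
    rw [← CrossedProduct.incl_sum, ht.sum_mul_star]
  refine ⟨e, f, ht.isStarProjection, ht.subalgebra, ht.matrixEquiv, he, heα, he0, ht.ne_zero he0,
    ht.isClosed_subalgebra, fun d hd => ⟨d, hd.1.symm⟩, ?_, fun a => ?_, fun g => ⟨_, hgg g⟩,
    fun g a => ?_, fun a ha => ?_, hsum, ?_, by linarith⟩
  · rw [← hsum]
    exact sum_mem fun g _ => (ht.matrixEquiv _).2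
  · rw [ht.matrixEquiv_matrixTensor_self, ht.one, map_one,
      ht.isStarProjection.isSelfAdjoint.star_eq]
    exact congrArg _ ((mem_cornerAlg_iff ht.isStarProjection).1 a.2)
  · rw [ht.matrixEquiv_matrixTensor_self, ← CrossedProduct.incl_sub, CrossedProduct.norm_incl]
    have hf := ht.isStarProjection.action α g
    have e1 : α g (a : A) = α g f * α g (a : A) * α g f := by
      rw [← map_mul, ← map_mul, (mem_cornerAlg_iff ht.isStarProjection).1 a.2]
    nth_rw 2 [e1]
    refine (norm_mul_mul_sub_le _ _ _ _ _).trans ?_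
    have h1 : ‖star (t g) - α g f‖ ≤ δ := by
      rw [← hf.isSelfAdjoint.star_eq, ← star_sub, norm_star]; exact htf g
    rw [norm_action, norm_star]
    calc _ ≤ δ * ‖(a : A)‖ * 1 + 1 * ‖(a : A)‖ * δ := by
          have := ht.norm_le_one g
          have := hf.norm_le_one
          have := htf g
          gcongr
      _ = 2 * δ * ‖(a : A)‖ := by ring
      _ ≤ ε * ‖(a : A)‖ := by gcongr; linarith
  · obtain ⟨b, hb, hb1, hb2, hba⟩ :=
      ht.exists_mem_subalgebra_approx he a hδ0 (hcomm a ha) (hdiag a ha)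
    have h3 : 3 * (Fintype.card G : ℝ) ^ 3 * δ < ε := by nlinarith
    exact ⟨(hcomm a ha).trans_lt (by linarith), b, hb, b, hb, hb1.trans_lt h3, hb2.trans_lt h3,
      hba, hba⟩
  · exact (cuntzLE_of_le (cutDown_nonneg _ _) (cutDown_anti hδ0.le (by linarith))).trans hcut
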